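/- Let $M$ be a compact connected $3$-manifold (possibly with boundary) with fundamental group $\pi$, let $H=H_1(M)=\pi/[\pi,\pi]$, written multiplicatively, let $\operatorname{Tors}H$ be its torsion subgroup, $G=H/\operatorname{Tors}H$, and $\sigma\in\operatorname{Hom}(\operatorname{Tors}H,\mathbb C^*)$. *The Alexander–Fox norm.* Let $\langle x_1,\dots,x_n\mid r_1,r_2,\dots\rangle$ be any presentation of $\pi$ with finitely many generators, and let $E\subset\mathbb Z[H]$ be the first elementary ideal of $\pi$, generated by the $(n-1)\times(n-1)$ minors of the matrix of the images in $\mathbb Z[H]$ of the free derivatives $\partial r_i/\partial x_j$. Fix any splitting $H=\operatorname{Tors}H\times G$, let $\tilde\sigma:\mathbb Z[H]\to\mathbb C[G]$ be the ring homomorphism with $\tilde\sigma(hg)=\sigma(h)g$ for $h\in\operatorname{Tors}H$, $g\in G$, and let $\Delta^\sigma=\sum_{g}c_g\,g$ be a greatest common divisor of $\tilde\sigma(E)$ in $\mathbb C[G]$. For $\psi\in H^1(M)=\operatorname{Hom}(\pi,\mathbb Z)$ put $\|\psi\|^\sigma=\max\{|\psi(g)-\psi(g')| : c_gc_{g'}\ne0\}$,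 and $\|\psi\|^\sigma=0$ if $\Delta^\sigma=0$. *The homomorphism $\varphi$.* Let $\psi\in H^1(M)$ be primitive and let $\tau\in H$ satisfy $\psi(\tau)=1$. Let $U$ be the kernel of the epimorphism $G\to\mathbb Z$ induced by $\psi$, let $K$ be the quotient field of $\mathbb C[U]$, and let $\Lambda=K[t^{\pm1}]$. Fix any splitting $H=\operatorname{Tors}H\times U\times(\tau)$, where $(\tau)$ is the infinite cyclic group generated by $\tau$, and let $\varphi:\mathbb Z[\pi]\to\Lambda$ be the composition of the projection $\mathbb Z[\pi]\to\mathbb Z[H]$ with the ring homomorphism $hu\tau^m\mapsto\sigma(h)\,u\,t^m$ ($h\in\operatorname{Tors}H$, $u\in U$, $m\in\mathbb Z$). Let $H_1(M;\Lambda)=H_1(C_*(\tilde M)\otimes_{\mathbb Z[\pi]}\Lambda)$ be the homology of $M$ twisted by $\varphi$, where $\tilde M$ is the universal covering of $M$. Then: 1. $\varphi$ is compatible with $\psi$, that is, $\varphi(\gamma)\in t^{\psi(\gamma)}K$ for all $\gamma\in\pi$; and the multiplicative group $\varphi(\pi)$ is cyclic if and only if $\sigma=1$ and $b_1(M)=1$.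 2. If $H_1(M;\Lambda)$ is finitely generated over $K$, then $\operatorname{rk}_KH_1(M;\Lambda)=\|\psi\|^\sigma$. 3. If $H_1(M;\Lambda)$ is not finitely generated over $K$, then $\|\psi\|^\sigma=0$. -/

import Mathlib

universe u v

noncomputable section

/-! ## Singular chains of the universal covering and twisted homology -/

/-- The standard geometric `n`-simplex `Δⁿ ⊂ ℝⁿ⁺¹`. -/
abbrev GeomSimplex (n : ℕ) : Type := stdSimplex ℝ (Fin (n + 1))

namespace GeomSimplex

/-- The initial vertex `e₀` of `Δⁿ`. -/
def init (n : ℕ) : GeomSimplex n := stdSimplex.vertex 0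

/-- The `i`-th face inclusion `Δⁿ → Δⁿ⁺¹`, omitting the `i`-th vertex. -/
def face (n : ℕ) (i : Fin (n + 2)) : C(GeomSimplex n, GeomSimplex (n + 1)) where
  toFun := stdSimplex.map i.succAbove
  continuous_toFun := stdSimplex.continuous_map _

/-- The straight segment from `p` to `q` in `Δⁿ`. -/
def segment {n : ℕ} (p q : GeomSimplex n) : Path p q where
  toFun t := ⟨AffineMap.lineMap (p : Fin (n + 1) → ℝ) (q : Fin (n + 1) → ℝ) (t : ℝ),
    (convex_stdSimplex ℝ (Fin (n + 1))).lineMap_mem p.2 q.2 t.2⟩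
  continuous_toFun := by
    refine Continuous.subtype_mk ?_ _
    exact (AffineMap.lineMap_continuous).comp continuous_subtype_val
  source' := Subtype.ext (AffineMap.lineMap_apply_zero _ _)
  target' := Subtype.ext (AffineMap.lineMap_apply_one _ _)

end GeomSimplex

/-- A singular `n`-simplex of the universal covering `X̃ → X` of the pointed space `(X, x)`.
A point of `X̃` over `y` is a homotopy class of paths in `X` from `x` to `y`, and a singular simplex
of `X̃` is determined (unique lifting) by its projection `Δⁿ → X` together with the point of `X̃` at
which it puts the initial vertex of `Δⁿ`. -/
@[ext]
structure LiftedSimplex (X : Type u) [TopologicalSpace X] (x : X) (n : ℕ) where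
  toMap : C(GeomSimplex n, X)
  path : Path.Homotopic.Quotient x (toMap (GeomSimplex.init n))

namespace LiftedSimplex

variable {X : Type u} [TopologicalSpace X] {x : X} {n : ℕ}

/-- The right action `s · γ` of a loop class `γ` on the simplices of the universal covering: the
usual left action of `γ⁻¹`, which puts `γ⁻¹` in front of paths starting at the base point. -/
def act (s : LiftedSimplex X x n) (γ : FundamentalGroup X x) : LiftedSimplex X x n where
  toMap := s.toMap
  path := (FundamentalGroup.toPath γ).symm.trans s.path

/-- The `i`-th face of a singular simplex of the universal covering. -/
def face (s : LiftedSimplex X x (n + 1)) (i : Fin (n + 2)) : LiftedSimplex X x n where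
  toMap := s.toMap.comp (GeomSimplex.face n i)
  path := s.path.trans (Path.Homotopic.Quotient.mk
    ((GeomSimplex.segment (GeomSimplex.init (n + 1))
      (GeomSimplex.face n i (GeomSimplex.init n))).map s.toMap.continuous))

theorem act_face (s : LiftedSimplex X x (n + 1)) (γ : FundamentalGroup X x) (i : Fin (n + 2)) :
    (s.act γ).face i = (s.face i).act γ := by
  have h : (s.act γ).path.trans (Path.Homotopic.Quotient.mk
      ((GeomSimplex.segment (GeomSimplex.init (n + 1))
        (GeomSimplex.face n i (GeomSimplex.init n))).map s.toMap.continuous)) =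
      (FundamentalGroup.toPath γ).symm.trans (s.face i).path :=
    CategoryTheory.Category.assoc (obj := FundamentalGroupoid X)
      (W := ⟨x⟩) (X := ⟨x⟩) (Y := ⟨s.toMap (GeomSimplex.init (n + 1))⟩)
      (Z := ⟨s.toMap (GeomSimplex.face n i (GeomSimplex.init n))⟩) _ _ _
  exact congrArg (LiftedSimplex.mk (s.toMap.comp (GeomSimplex.face n i))) h

end LiftedSimplex

namespace TwistedHomology

variable {X : Type u} [TopologicalSpace X] {x : X} {R : Type v} [CommRing R]

/-- The relations `s · γ ⊗ 1 = s ⊗ φ(γ)` of the tensor product over `ℤ[π]`. -/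
def relations (φ : MonoidAlgebra ℤ (FundamentalGroup X x) →+* R) (n : ℕ) :
    Submodule R (LiftedSimplex X x n →₀ R) :=
  Submodule.span R {c | ∃ (s : LiftedSimplex X x n) (γ : FundamentalGroup X x),
    c = Finsupp.single (s.act γ) 1 - Finsupp.single s (φ (MonoidAlgebra.of ℤ _ γ))}

/-- The `R`-module of twisted chains `C_n(X̃) ⊗_{ℤ[π]} R`. -/
abbrev Chain (φ : MonoidAlgebra ℤ (FundamentalGroup X x) →+* R) (n : ℕ) : Type (max u v) :=
  (LiftedSimplex X x n →₀ R) ⧸ relations φ n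

/-- The alternating sum of the faces, on the free `R`-module on the simplices. -/
def freeBoundary (X : Type u) [TopologicalSpace X] (x : X) (R : Type v) [CommRing R] (n : ℕ) :
    (LiftedSimplex X x (n + 1) →₀ R) →ₗ[R] (LiftedSimplex X x n →₀ R) :=
  Finsupp.lsum R fun s => ∑ i : Fin (n + 2), ((-1 : R) ^ (i : ℕ)) • Finsupp.lsingle (s.face i)

theorem relations_le (φ : MonoidAlgebra ℤ (FundamentalGroup X x) →+* R) (n : ℕ) :
    relations φ (n + 1) ≤ (relations φ n).comap (freeBoundary X x R n) := by
  refine Submodule.span_le.2 ?_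
  rintro _ ⟨s, γ, rfl⟩
  have h : freeBoundary X x R n
      (Finsupp.single (s.act γ) 1 - Finsupp.single s (φ (MonoidAlgebra.of ℤ _ γ))) =
      ∑ i : Fin (n + 2), ((-1 : R) ^ (i : ℕ)) •
        (Finsupp.single ((s.face i).act γ) 1 -
          Finsupp.single (s.face i) (φ (MonoidAlgebra.of ℤ _ γ))) := by
    rw [map_sub, freeBoundary, Finsupp.lsum_single, Finsupp.lsum_single]
    simp only [LinearMap.sum_apply, LinearMap.smul_apply, Finsupp.lsingle_apply,
      LiftedSimplex.act_face, smul_sub, Finset.sum_sub_distrib]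
  rw [SetLike.mem_coe, Submodule.mem_comap, h]
  exact Submodule.sum_mem _ fun i _ =>
    Submodule.smul_mem _ _ (Submodule.subset_span ⟨s.face i, γ, rfl⟩)

/-- The boundary homomorphism `C_{n+1}(X̃) ⊗ R → C_n(X̃) ⊗ R`. -/
def boundary (φ : MonoidAlgebra ℤ (FundamentalGroup X x) →+* R) (n : ℕ) :
    Chain φ (n + 1) →ₗ[R] Chain φ n :=
  (relations φ (n + 1)).mapQ (relations φ n) (freeBoundary X x R n) (relations_le φ n)

end TwistedHomology

open TwistedHomology in
/-- The first twisted homology `H₁(X; R) = H₁(C_*(X̃) ⊗_{ℤ[π]} R)`: one-cycles modulo boundaries. -/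
def TwistedH1 {X : Type u} [TopologicalSpace X] {x : X} {R : Type v} [CommRing R]
    (φ : MonoidAlgebra ℤ (FundamentalGroup X x) →+* R) : Type (max u v) :=
  LinearMap.ker (boundary φ 0) ⧸
    (LinearMap.range (boundary φ 1)).comap (LinearMap.ker (boundary φ 0)).subtype

namespace TwistedH1

variable {X : Type u} [TopologicalSpace X] {x : X} {R : Type v} [CommRing R]
  (φ : MonoidAlgebra ℤ (FundamentalGroup X x) →+* R)

instance : AddCommGroup (TwistedH1 φ) :=
  inferInstanceAs (AddCommGroup (_ ⧸ (LinearMap.range (TwistedHomology.boundary φ 1)).comap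
    (LinearMap.ker (TwistedHomology.boundary φ 0)).subtype))

instance : Module R (TwistedH1 φ) :=
  inferInstanceAs (Module R (_ ⧸ (LinearMap.range (TwistedHomology.boundary φ 1)).comap
    (LinearMap.ker (TwistedHomology.boundary φ 0)).subtype))

end TwistedH1

/-! ## Fox calculus and the first elementary ideal -/

section Fox

variable {ι : Type} [DecidableEq ι]

/-- The permutation `a ↦ x_i a + δ_{ij}` of `ℤ[F]`. -/
def foxPerm (j i : ι) : Equiv.Perm (MonoidAlgebra ℤ (FreeGroup ι)) where
  toFun a := MonoidAlgebra.of ℤ _ (FreeGroup.of i) * a + if i = j then 1 else 0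
  invFun a := MonoidAlgebra.of ℤ _ (FreeGroup.of i)⁻¹ * (a - if i = j then 1 else 0)
  left_inv a := by
    simp only [add_sub_cancel_right]
    rw [← mul_assoc, ← map_mul, inv_mul_cancel, map_one, one_mul]
  right_inv a := by
    beta_reduce
    rw [← mul_assoc, ← map_mul, mul_inv_cancel, map_one, one_mul, sub_add_cancel]

/-- The free derivative `∂w/∂x_j ∈ ℤ[F]` of an element `w` of the free group `F`. It is the value
at `0` of the affine map `a ↦ w a + ∂w/∂x_j`, which is multiplicative in `w`; the lemmas below show
that it is the derivation with `∂x_i/∂x_j = δ_{ij}`. -/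
def foxDeriv (j : ι) (w : FreeGroup ι) : MonoidAlgebra ℤ (FreeGroup ι) :=
  FreeGroup.lift (foxPerm j) w 0

theorem foxDeriv_of (j i : ι) : foxDeriv j (FreeGroup.of i) = if i = j then 1 else 0 := by
  simp [foxDeriv, foxPerm]

theorem lift_foxPerm_apply (j : ι) (w : FreeGroup ι) (a : MonoidAlgebra ℤ (FreeGroup ι)) :
    FreeGroup.lift (foxPerm j) w a = MonoidAlgebra.of ℤ _ w * a + foxDeriv j w := by
  have key : ∀ u v : FreeGroup ι,
      (∀ a, FreeGroup.lift (foxPerm j) u a = MonoidAlgebra.of ℤ _ u * a + foxDeriv j u) →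
      (∀ a, FreeGroup.lift (foxPerm j) v a = MonoidAlgebra.of ℤ _ v * a + foxDeriv j v) →
      ∀ a, FreeGroup.lift (foxPerm j) (u * v) a =
        MonoidAlgebra.of ℤ _ (u * v) * a + foxDeriv j (u * v) := by
    intro u v hu hv a
    have h : foxDeriv j (u * v) = MonoidAlgebra.of ℤ _ u * foxDeriv j v + foxDeriv j u := by
      rw [foxDeriv, map_mul, Equiv.Perm.mul_apply, hu]; rfl
    rw [h, map_mul, Equiv.Perm.mul_apply, hv, hu, map_mul, mul_add, mul_assoc, add_assoc]
  induction w using FreeGroup.induction_on generalizing a with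
  | C1 => simp [foxDeriv, ← MonoidAlgebra.one_def]
  | of i => simp [foxDeriv, foxPerm]
  | inv_of i _ => simp [foxDeriv, foxPerm, sub_eq_add_neg, mul_add]
  | mul u v hu hv => exact key u v hu hv a

/-- The Leibniz rule of the free differential calculus. -/
theorem foxDeriv_mul (j : ι) (u v : FreeGroup ι) :
    foxDeriv j (u * v) = foxDeriv j u + MonoidAlgebra.of ℤ _ u * foxDeriv j v := by
  rw [foxDeriv, map_mul, Equiv.Perm.mul_apply, lift_foxPerm_apply, add_comm]; rfl

end Fox

/-- A presentation `⟨x_1, …, x_n | r ∈ rels⟩` of the group `Γ` with finitely many generators. -/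
structure FinGenPresentation (Γ : Type u) [Group Γ] where
  n : ℕ
  proj : FreeGroup (Fin n) →* Γ
  rels : Set (FreeGroup (Fin n))
  proj_surjective : Function.Surjective proj
  ker_proj : proj.ker = Subgroup.normalClosure rels

namespace FinGenPresentation

variable {Γ : Type u} [Group Γ] (P : FinGenPresentation Γ)

/-- The Alexander matrix: the free derivatives `∂r/∂x_j`, pushed to `ℤ[H₁(Γ)]`. -/
def alexanderMatrix : Matrix P.rels (Fin P.n) (MonoidAlgebra ℤ (Abelianization Γ)) :=
  Matrix.of fun r j =>
    MonoidAlgebra.mapDomainRingHom ℤ (Abelianization.of.comp P.proj) (foxDeriv j r.1)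

/-- The first elementary ideal `E₁(Γ) ⊂ ℤ[H₁(Γ)]`, generated by the `(n-1) × (n-1)`-minors of the
Alexander matrix. -/
def elementaryIdeal : Ideal (MonoidAlgebra ℤ (Abelianization Γ)) :=
  Ideal.span {d | ∃ (r : Fin (P.n - 1) → P.rels) (c : Fin (P.n - 1) → Fin P.n),
    d = (P.alexanderMatrix.submatrix r c).det}

end FinGenPresentation

/-! ## The Alexander-Fox norm -/

/-- `G = H / Tors H` -/
abbrev FreeQuot (H : Type u) [CommGroup H] : Type u := H ⧸ CommGroup.torsion H

/-- A splitting `H = Tors H × G`, given by a section of the projection `H → G = H / Tors H`. -/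
structure TorsionSplitting (H : Type u) [CommGroup H] where
  lift : FreeQuot H →* H
  mk_lift : ∀ g : FreeQuot H, (lift g : FreeQuot H) = g

namespace TorsionSplitting

variable {H : Type u} [CommGroup H] (s : TorsionSplitting H)

/-- The projection `H = Tors H × G → Tors H`. -/
def torsionPart : H →* CommGroup.torsion H where
  toFun h := ⟨h * (s.lift h)⁻¹, by
    rw [← QuotientGroup.eq_one_iff, QuotientGroup.mk_mul, QuotientGroup.mk_inv, s.mk_lift,
      mul_inv_cancel]⟩
  map_one' := by ext; simp
  map_mul' a b := by
    ext
    simp only [QuotientGroup.mk_mul, map_mul, mul_inv, Subgroup.coe_mul]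
    exact mul_mul_mul_comm _ _ _ _

/-- The ring homomorphism `ℤ[H] → ℂ[G]` sending `h g` with `h ∈ Tors H`, `g ∈ G` to `σ(h) g`. -/
def twist (σ : CommGroup.torsion H →* ℂˣ) :
    MonoidAlgebra ℤ H →+* MonoidAlgebra ℂ (FreeQuot H) :=
  MonoidAlgebra.liftNCRingHom (Int.castRingHom (MonoidAlgebra ℂ (FreeQuot H)))
    { toFun := fun h => MonoidAlgebra.single (h : FreeQuot H) (σ (s.torsionPart h) : ℂ)
      map_one' := by simp [MonoidAlgebra.one_def]
      map_mul' := fun a b => by simp [MonoidAlgebra.single_mul_single] }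
    fun _ _ => Commute.all _ _

end TorsionSplitting

/-- `d` is a greatest common divisor of the set `S`. -/
def IsGcdOfSet {R : Type u} [CommRing R] (S : Set R) (d : R) : Prop :=
  ∀ e : R, e ∣ d ↔ ∀ a ∈ S, e ∣ a

open Classical in
/-- A greatest common divisor of the set `S` (zero if there is none). -/
def gcdOfSet {R : Type u} [CommRing R] (S : Set R) : R :=
  if h : ∃ d, IsGcdOfSet S d then h.choose else 0

/-- The homomorphism `H₁(Γ) / Tors H₁(Γ) → ℤ` induced by a class
`ψ ∈ H¹(Γ) = Hom(Γ, ℤ)`. -/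
def inducedClass {Γ : Type u} [Group Γ] (ψ : Γ →* Multiplicative ℤ) :
    FreeQuot (Abelianization Γ) →* Multiplicative ℤ :=
  QuotientGroup.lift _ (Abelianization.lift ψ) fun _ hh =>
    (isOfFinOrder_iff_eq_one _).1 ((Abelianization.lift ψ).isOfFinOrder hh)

theorem inducedClass_mk {Γ : Type u} [Group Γ] (ψ : Γ →* Multiplicative ℤ) (h : Abelianization Γ) :
    inducedClass ψ (h : FreeQuot (Abelianization Γ)) = Abelianization.lift ψ h := rfl

/-- The maximum of `|ψ(g) - ψ(g')|` over all `g, g'` that occur in `Δ ∈ ℂ[G]` with non-zero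
coefficients; zero if `Δ = 0`. -/
def spread {G : Type u} [CommGroup G] (ψ : G →* Multiplicative ℤ) (Δ : MonoidAlgebra ℂ G) : ℕ :=
  (Δ.coeff.support ×ˢ Δ.coeff.support).sup fun p =>
    ((ψ p.1).toAdd - (ψ p.2).toAdd).natAbs

namespace FinGenPresentation

variable {Γ : Type u} [Group Γ] (P : FinGenPresentation Γ)

/-- The twisted Alexander polynomial `Δ^σ(Γ) = gcd σ̃(E₁(Γ)) ∈ ℂ[G]`. -/
def alexanderPolynomial (s : TorsionSplitting (Abelianization Γ))
    (σ : CommGroup.torsion (Abelianization Γ) →* ℂˣ) :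
    MonoidAlgebra ℂ (FreeQuot (Abelianization Γ)) :=
  gcdOfSet (s.twist σ '' P.elementaryIdeal)

/-- The Alexander-Fox norm `‖ψ‖^σ`. -/
def alexanderFoxNorm (s : TorsionSplitting (Abelianization Γ))
    (σ : CommGroup.torsion (Abelianization Γ) →* ℂˣ) (ψ : Γ →* Multiplicative ℤ) : ℕ :=
  spread (inducedClass ψ) (P.alexanderPolynomial s σ)

end FinGenPresentation

/-! ## The field `K` and the homomorphism `φ : ℤ[π] → K[t^{±1}]` -/

section Phi

variable {Γ : Type u} [Group Γ]

/-- The quotient field `K` of `ℂ[U]`, where `U` is the kernel of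
`ψ : H₁(Γ) / Tors H₁(Γ) → ℤ`. -/
abbrev CoeffField (ψ : Γ →* Multiplicative ℤ) : Type u :=
  FractionRing (MonoidAlgebra ℂ (inducedClass ψ).ker)

/-- A torsion-free abelian group has unique products: it is enough to look at its finitely generated
subgroups. -/
theorem uniqueProds_of_torsionFree (A : Type u) [CommGroup A] [IsMulTorsionFree A] :
    UniqueProds A where
  uniqueMul_of_nonempty {S T} hS hT := by
    classical
    let B : Subgroup A := Subgroup.closure ((S ∪ T : Finset A) : Set A)
    have hB : ∀ a ∈ S ∪ T, a ∈ B := fun a ha => Subgroup.subset_closure ha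
    have hfg : Group.FG B := (Group.fg_iff_subgroup_fg B).2 ⟨S ∪ T, rfl⟩
    have : Monoid.FG B := Group.fg_iff_monoid_fg.1 hfg
    have : IsMulTorsionFree B := Subgroup.instIsMulTorsionFree B
    obtain ⟨a₀, ha₀⟩ := hS
    obtain ⟨b₀, hb₀⟩ := hT
    obtain ⟨a, ha, b, hb, h⟩ := UniqueProds.uniqueMul_of_nonempty
      (A := S.subtype (· ∈ B)) (B := T.subtype (· ∈ B))
      ⟨⟨a₀, hB _ (Finset.mem_union_left _ ha₀)⟩, Finset.mem_subtype.2 ha₀⟩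
      ⟨⟨b₀, hB _ (Finset.mem_union_right _ hb₀)⟩, Finset.mem_subtype.2 hb₀⟩
    refine ⟨a, Finset.mem_subtype.1 ha, b, Finset.mem_subtype.1 hb, fun c d hc hd hcd => ?_⟩
    have := h (a := ⟨c, hB _ (Finset.mem_union_left _ hc)⟩)
      (b := ⟨d, hB _ (Finset.mem_union_right _ hd)⟩)
      (Finset.mem_subtype.2 hc) (Finset.mem_subtype.2 hd) (Subtype.ext hcd)
    exact ⟨congrArg Subtype.val this.1, congrArg Subtype.val this.2⟩

/-- `ℂ[U]` is a domain, so that its total ring of fractions `K` is a field. -/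
instance isDomain_kerAlgebra (ψ : Γ →* Multiplicative ℤ) :
    IsDomain (MonoidAlgebra ℂ (inducedClass ψ).ker) :=
  have : UniqueProds (inducedClass ψ).ker := uniqueProds_of_torsionFree _
  inferInstance

/-- The component in `U` of `g ∈ G = U × (τ)`, where `ψ(τ) = 1`; that is, `g τ^{-ψ(g)}`. -/
def kerPart (ψ : Γ →* Multiplicative ℤ) (τ : FreeQuot (Abelianization Γ))
    (hτ : inducedClass ψ τ = Multiplicative.ofAdd 1) :
    FreeQuot (Abelianization Γ) →* (inducedClass ψ).ker where
  toFun g := ⟨g * (τ ^ (inducedClass ψ g).toAdd)⁻¹, by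
    rw [MonoidHom.mem_ker, map_mul, map_inv, map_zpow, hτ, ← ofAdd_zsmul, smul_eq_mul, mul_one,
      ofAdd_toAdd, mul_inv_cancel]⟩
  map_one' := by ext; simp
  map_mul' a b := by
    ext
    simp only [map_mul, toAdd_mul, zpow_add, mul_inv, Subgroup.coe_mul]
    exact mul_mul_mul_comm _ _ _ _

/-- For a splitting `H = Tors H × U × (τ)` of `H = H₁(Γ)`, the homomorphism from `H` to the
multiplicative monoid of `Λ = K[t^{±1}]` sending `h u τ^m` to `σ(h) u t^m`. -/
def phiHom (s : TorsionSplitting (Abelianization Γ))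
    (σ : CommGroup.torsion (Abelianization Γ) →* ℂˣ) (ψ : Γ →* Multiplicative ℤ)
    (τ : Abelianization Γ) (hτ : Abelianization.lift ψ τ = Multiplicative.ofAdd 1) :
    Abelianization Γ →* LaurentPolynomial (CoeffField ψ) where
  toFun h := LaurentPolynomial.C (algebraMap (MonoidAlgebra ℂ (inducedClass ψ).ker) (CoeffField ψ)
      (MonoidAlgebra.single (kerPart ψ τ ((inducedClass_mk ψ τ).trans hτ) h) (σ (s.torsionPart h) : ℂ))) *
    LaurentPolynomial.T (inducedClass ψ h).toAdd
  map_one' := by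
    simp [← MonoidAlgebra.one_def]
  map_mul' a b := by
    have h : (MonoidAlgebra.single (kerPart ψ τ ((inducedClass_mk ψ τ).trans hτ) ((a * b : Abelianization Γ) :
          FreeQuot (Abelianization Γ))) (σ (s.torsionPart (a * b)) : ℂ)) =
        MonoidAlgebra.single (kerPart ψ τ ((inducedClass_mk ψ τ).trans hτ) a) (σ (s.torsionPart a) : ℂ) *
          MonoidAlgebra.single (kerPart ψ τ ((inducedClass_mk ψ τ).trans hτ) b) (σ (s.torsionPart b) : ℂ) := by
      simp [MonoidAlgebra.single_mul_single]
    rw [h, QuotientGroup.mk_mul, map_mul (inducedClass ψ), toAdd_mul, LaurentPolynomial.T_add,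
      map_mul, map_mul]
    exact mul_mul_mul_comm _ _ _ _

/-- The ring homomorphism `φ : ℤ[Γ] → ℤ[H₁(Γ)] → Λ = K[t^{±1}]`. -/
def phi (s : TorsionSplitting (Abelianization Γ))
    (σ : CommGroup.torsion (Abelianization Γ) →* ℂˣ) (ψ : Γ →* Multiplicative ℤ)
    (τ : Abelianization Γ) (hτ : Abelianization.lift ψ τ = Multiplicative.ofAdd 1) :
    MonoidAlgebra ℤ Γ →+* LaurentPolynomial (CoeffField ψ) :=
  MonoidAlgebra.liftNCRingHom (Int.castRingHom (LaurentPolynomial (CoeffField ψ)))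
    ((phiHom s σ ψ τ hτ).comp Abelianization.of) fun _ _ => Commute.all _ _

end Phi

/-- The `K`-module structure of `H₁(X; K[t^{±1}])` given by the inclusion `K ⊂ K[t^{±1}]`. -/
instance TwistedH1.instModuleCoeff {X : Type u} [TopologicalSpace X] {x : X} {K : Type v} [CommRing K]
    (φ : MonoidAlgebra ℤ (FundamentalGroup X x) →+* LaurentPolynomial K) :
    Module K (TwistedH1 φ) :=
  Module.compHom _ (LaurentPolynomial.C : K →+* LaurentPolynomial K)

end

/-! In degree one, twisted homology is determined by the fundamental group. By
`nonempty_equiv_ker_foxBoundary`, `H₁(M; Λ)` is the kernel of `foxBoundary` on the Alexander module,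
the `Λ`-module presented by the matrix of free derivatives. Both sides are governed by derivations
along `φ`: modulo boundaries, the class of an inverse loop is a derivation of the loop, and `foxD`
is the universal derivation.

Since `Λ` is a principal ideal domain, this kernel can be read off from minors. The functional `D`
induced on `Λⁿ` is nonzero, so `Λⁿ = Λv ⊕ N` with `N = ker D` free of rank `n - 1`, and the kernel
is `N` modulo the relations. By Smith normal form (`exists_submaximal_minors_generator`) the
`(n-1)`-minors generate an ideal `(f)`, and either the kernel is a sum of modules `Λ/(cᵢ)` with `f =
∏ cᵢ ≠ 0`, or `f = 0` and the kernel contains a copy of `Λ`. In the first case its dimension over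
`K` is the span of `f`, the highest exponent minus the lowest; in the second it is infinite.

It remains to compare `f` with `Δ^σ`. The map `phiTwist` embeds the factorial ring `ℂ[G]` in `Λ`,
which is a localization of it, so a gcd of `σ̃(E)` generates the extension of that ideal to `Λ`
(`span_image_eq_of_isGcdOfSet`). The exponents of `t` in the image of `Δ^σ` are exactly the values
of `ψ` on its support (`support_phiTwist`), so the span of `f` is the norm. The splittings used for
the norm and for `φ` may differ, but only by a character of `G`, which rescales coefficients by
nonzero numbers.

For cyclicity, `φ` separates elements of `H` exactly by their class in `G` and by `σ` of their
torsion part (`phiHom_eq_iff`). If the image is cyclic, then `ψ` detects the exponents of a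
generator, so `φ` kills `ker ψ`. -/

noncomputable section

/-! ## The Alexander module of a presentation -/

namespace FinGenPresentation

variable {Γ : Type u} [Group Γ] (P : FinGenPresentation Γ) {R : Type v} [CommRing R]
  (φ : MonoidAlgebra ℤ Γ →+* R)

/-- The vector of the free derivatives of a word, pushed to `R`. -/
def foxRow (w : FreeGroup (Fin P.n)) : Fin P.n → R :=
  fun j => φ (MonoidAlgebra.mapDomainRingHom ℤ P.proj (foxDeriv j w))

theorem foxRow_mul (v w : FreeGroup (Fin P.n)) :
    P.foxRow φ (v * w) =
      P.foxRow φ v + φ (MonoidAlgebra.of ℤ _ (P.proj v)) • P.foxRow φ w := by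
  ext j
  have h : MonoidAlgebra.mapDomainRingHom ℤ P.proj (MonoidAlgebra.of ℤ _ v) =
      MonoidAlgebra.of ℤ Γ (P.proj v) := by simp
  simp only [foxRow, foxDeriv_mul, map_add, map_mul, h, Pi.add_apply, Pi.smul_apply, smul_eq_mul]

theorem foxRow_one : P.foxRow φ 1 = 0 := by
  have h := P.foxRow_mul φ 1 1
  rw [map_one, map_one, map_one, one_smul, mul_one] at h
  exact left_eq_add.1 h

theorem foxRow_of (i : Fin P.n) : P.foxRow φ (FreeGroup.of i) = Pi.single i 1 := by
  ext j
  rw [foxRow, foxDeriv_of]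
  by_cases h : i = j
  · subst h; simp
  · rw [if_neg h, Pi.single_eq_of_ne (Ne.symm h), map_zero, map_zero]

/-- The span of the rows of the Alexander matrix. -/
def foxSpan : Submodule R (Fin P.n → R) :=
  Submodule.span R (P.foxRow φ '' P.rels)

/-- The module with one generator for each generator of `P` and presented by the Alexander
matrix. -/
abbrev FoxModule : Type v := (Fin P.n → R) ⧸ P.foxSpan φ

/-- The words with both properties form a subgroup, so only conjugates `c r c⁻¹` of relators matter.
As `r` maps to `1`, the contributions of `c` and `c⁻¹` cancel and `φ(c)` times the row of `r`
remains. -/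
theorem foxRow_mem_of_proj_eq_one {w : FreeGroup (Fin P.n)} (hw : P.proj w = 1) :
    P.foxRow φ w ∈ P.foxSpan φ := by
  have hw' : w ∈ Subgroup.normalClosure P.rels := by
    rw [← P.ker_proj]; exact hw
  have hrel : ∀ r ∈ P.rels, P.proj r = 1 := fun r hr => by
    have : r ∈ P.proj.ker := by rw [P.ker_proj]; exact Subgroup.subset_normalClosure hr
    exact this
  have hone : φ (MonoidAlgebra.of ℤ Γ 1) = 1 := by rw [map_one, map_one]
  have hinv : ∀ u : FreeGroup (Fin P.n), P.foxRow φ u⁻¹ =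
      -(φ (MonoidAlgebra.of ℤ _ (P.proj u⁻¹)) • P.foxRow φ u) := fun u => by
    have h := P.foxRow_mul φ u⁻¹ u
    rw [inv_mul_cancel, foxRow_one] at h
    exact eq_neg_of_add_eq_zero_left h.symm
  have key : Subgroup.normalClosure P.rels ≤
      { carrier := {u | P.proj u = 1 ∧ P.foxRow φ u ∈ P.foxSpan φ}
        mul_mem' := fun {a b} ha hb => ⟨by rw [map_mul, ha.1, hb.1, one_mul], by
          rw [foxRow_mul]
          exact Submodule.add_mem _ ha.2 (Submodule.smul_mem _ _ hb.2)⟩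
        one_mem' := ⟨map_one _, by rw [foxRow_one]; exact Submodule.zero_mem _⟩
        inv_mem' := fun {a} ha => ⟨by rw [map_inv, ha.1, inv_one], by
          rw [hinv]
          exact Submodule.neg_mem _ (Submodule.smul_mem _ _ ha.2)⟩ } := by
    refine (Subgroup.closure_le _).2 ?_
    intro u hu
    obtain ⟨r, hr, hru⟩ := Group.mem_conjugatesOfSet_iff.1 hu
    obtain ⟨c, rfl⟩ := isConj_iff.1 hru
    refine ⟨by simp [hrel r hr], ?_⟩
    rw [foxRow_mul, foxRow_mul, hinv, map_mul, hrel r hr, mul_one, smul_neg, smul_smul,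
      ← map_mul φ, ← map_mul, ← map_mul, mul_inv_cancel, map_one, hone, one_smul,
      add_neg_cancel_comm]
    exact Submodule.smul_mem _ _ (Submodule.subset_span ⟨r, hr, rfl⟩)
  exact (key hw').2

/-- The universal `φ`-derivation `Γ → FoxModule`. -/
def foxD (γ : Γ) : P.FoxModule φ :=
  (P.foxSpan φ).mkQ (P.foxRow φ (P.proj_surjective γ).choose)

theorem foxD_proj (w : FreeGroup (Fin P.n)) :
    P.foxD φ (P.proj w) = (P.foxSpan φ).mkQ (P.foxRow φ w) := by
  set v := (P.proj_surjective (P.proj w)).choose with hv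
  have hvw : P.proj v = P.proj w := (P.proj_surjective (P.proj w)).choose_spec
  have h : P.foxRow φ v = P.foxRow φ (v * w⁻¹) + P.foxRow φ w := by
    have := P.foxRow_mul φ (v * w⁻¹) w
    rwa [inv_mul_cancel_right, map_mul, map_inv, hvw, mul_inv_cancel, map_one, map_one,
      one_smul] at this
  have hm : P.foxRow φ (v * w⁻¹) ∈ P.foxSpan φ :=
    P.foxRow_mem_of_proj_eq_one φ (by rw [map_mul, map_inv, hvw, mul_inv_cancel])
  rw [foxD, ← hv, h, map_add, Submodule.mkQ_apply, (Submodule.Quotient.mk_eq_zero _).2 hm, zero_add]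

theorem foxD_mul (γ δ : Γ) :
    P.foxD φ (γ * δ) = P.foxD φ γ + φ (MonoidAlgebra.of ℤ _ γ) • P.foxD φ δ := by
  obtain ⟨v, rfl⟩ := P.proj_surjective γ
  obtain ⟨w, rfl⟩ := P.proj_surjective δ
  rw [← map_mul, foxD_proj, foxD_proj, foxD_proj, foxRow_mul, map_add, map_smul]

/-- The fundamental formula of the free calculus: both sides are derivations in `w`, and they agree
on the generators. -/
theorem derivation_eq_sum {N : Type*} [AddCommGroup N] [Module R N] (D : Γ → N)
    (hD : ∀ γ δ, D (γ * δ) = D γ + φ (MonoidAlgebra.of ℤ _ γ) • D δ)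
    (w : FreeGroup (Fin P.n)) :
    ∑ j, P.foxRow φ w j • D (P.proj (FreeGroup.of j)) = D (P.proj w) := by
  have h1 : D 1 = 0 := by
    have h := hD 1 1
    rw [map_one, map_one, one_smul, mul_one] at h
    exact left_eq_add.1 h
  have hof : ∀ i, ∑ j, P.foxRow φ (FreeGroup.of i) j • D (P.proj (FreeGroup.of j)) =
      D (P.proj (FreeGroup.of i)) := fun i => by
    rw [foxRow_of]
    simp [Pi.single_apply]
  have hmul : ∀ u v, ∑ j, P.foxRow φ (u * v) j • D (P.proj (FreeGroup.of j)) =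
      ∑ j, P.foxRow φ u j • D (P.proj (FreeGroup.of j)) +
        φ (MonoidAlgebra.of ℤ _ (P.proj u)) •
          ∑ j, P.foxRow φ v j • D (P.proj (FreeGroup.of j)) := fun u v => by
    rw [foxRow_mul, Finset.smul_sum, ← Finset.sum_add_distrib]
    refine Finset.sum_congr rfl fun j _ => ?_
    rw [Pi.add_apply, Pi.smul_apply, add_smul, smul_assoc]
  induction w using FreeGroup.induction_on with
  | C1 => simp [foxRow_one, h1]
  | of i => exact hof i
  | inv_of i _ =>
    -- Expanding `x⁻¹ x = 1` on both sides shows that a derivation is determined at `x⁻¹` by its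
    -- value at `x`.
    have a := hmul (FreeGroup.of i)⁻¹ (FreeGroup.of i)
    have b := hD (P.proj (FreeGroup.of i)⁻¹) (P.proj (FreeGroup.of i))
    rw [hof] at a
    rw [← map_mul, inv_mul_cancel, map_one, h1] at b
    rw [inv_mul_cancel] at a
    simp only [foxRow_one, Pi.zero_apply, zero_smul, Finset.sum_const_zero] at a
    exact add_right_cancel (a.symm.trans b)
  | mul u v hu hv => rw [hmul, hu, hv, map_mul, hD]

/-- The linear map from the Alexander module defined by a derivation of the group. -/
def foxLift {N : Type*} [AddCommGroup N] [Module R N] (D : Γ → N)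
    (hD : ∀ γ δ, D (γ * δ) = D γ + φ (MonoidAlgebra.of ℤ _ γ) • D δ) :
    P.FoxModule φ →ₗ[R] N :=
  (P.foxSpan φ).liftQ (Fintype.linearCombination R fun j => D (P.proj (FreeGroup.of j))) <| by
    refine Submodule.span_le.2 ?_
    rintro _ ⟨r, hr, rfl⟩
    have hr1 : P.proj r = 1 := by
      have : r ∈ P.proj.ker := by rw [P.ker_proj]; exact Subgroup.subset_normalClosure hr
      exact this
    have h1 : D 1 = 0 := by
      have h := hD 1 1
      rw [map_one, map_one, one_smul, mul_one] at h
      exact left_eq_add.1 h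
    rw [SetLike.mem_coe, LinearMap.mem_ker, Fintype.linearCombination_apply,
      P.derivation_eq_sum φ D hD, hr1, h1]

theorem foxLift_foxD {N : Type*} [AddCommGroup N] [Module R N] (D : Γ → N)
    (hD : ∀ γ δ, D (γ * δ) = D γ + φ (MonoidAlgebra.of ℤ _ γ) • D δ) (γ : Γ) :
    P.foxLift φ D hD (P.foxD φ γ) = D γ := by
  obtain ⟨w, rfl⟩ := P.proj_surjective γ
  rw [foxD_proj]
  exact P.derivation_eq_sum φ D hD w

theorem foxModule_hom_ext {N : Type*} [AddCommGroup N] [Module R N]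
    {f g : P.FoxModule φ →ₗ[R] N} (h : ∀ γ, f (P.foxD φ γ) = g (P.foxD φ γ)) : f = g := by
  refine Submodule.linearMap_qext _ ((Pi.basisFun R (Fin P.n)).ext fun i => ?_)
  have := h (P.proj (FreeGroup.of i))
  rw [foxD_proj, foxRow_of] at this
  simpa using this

/-- The map `FoxModule → R` sending the derivative of `γ` to `φ(γ) - 1`. -/
def foxBoundary : P.FoxModule φ →ₗ[R] R :=
  P.foxLift φ (fun γ => φ (MonoidAlgebra.of ℤ _ γ) - 1) fun γ δ => by
    rw [map_mul, map_mul, smul_eq_mul]; ring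

theorem foxBoundary_foxD (γ : Γ) :
    P.foxBoundary φ (P.foxD φ γ) = φ (MonoidAlgebra.of ℤ _ γ) - 1 :=
  P.foxLift_foxD φ _ _ γ

end FinGenPresentation
end

noncomputable section

/-! ## Low-dimensional singular simplices of the universal covering -/

namespace LiftedSimplex

open GeomSimplex

variable {X : Type u} [TopologicalSpace X] {x : X} {n : ℕ}

/-- The lifted simplex over `f` whose initial vertex is the class `a`. -/
def of (f : C(GeomSimplex n, X)) {y : X} (hy : f (init n) = y)
    (a : Path.Homotopic.Quotient x y) : LiftedSimplex X x n :=
  ⟨f, a.cast rfl hy⟩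

theorem of_rfl (f : C(GeomSimplex n, X)) (a : Path.Homotopic.Quotient x (f (init n))) :
    of f rfl a = ⟨f, a⟩ := by
  rw [of, Path.Homotopic.Quotient.cast_rfl_rfl]

theorem of_self (s : LiftedSimplex X x n) : of s.toMap rfl s.path = s := of_rfl _ _

theorem of_congr {f g : C(GeomSimplex n, X)} (h : f = g) {y : X} (hf : f (init n) = y)
    (hg : g (init n) = y) (a : Path.Homotopic.Quotient x y) : of f hf a = of g hg a := by
  subst h; rfl

theorem act_of (f : C(GeomSimplex n, X)) {y : X} (hy : f (init n) = y)
    (a : Path.Homotopic.Quotient x y) (γ : FundamentalGroup X x) :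
    (of f hy a).act γ = of f hy ((FundamentalGroup.toPath γ).symm.trans a) := by
  subst hy
  rw [of_rfl, of_rfl]
  rfl

theorem of_trans_mk_congr (f : C(GeomSimplex n, X)) {y z z' : X} (hz : f (init n) = z)
    (hz' : f (init n) = z') (a : Path.Homotopic.Quotient x y) (q : Path y z) (q' : Path y z')
    (h : ∀ t, q t = q' t) :
    of f hz (a.trans (.mk q)) = of f hz' (a.trans (.mk q')) := by
  subst hz
  subst hz'
  rw [show q = q' from Path.ext (funext h)]

/-- Allows the transporting path to be any `q` with the right values, so that its endpoints need
agree only propositionally with those in the definition of a face. -/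
theorem face_of (f : C(GeomSimplex (n + 1), X)) {y z : X} (hy : f (init (n + 1)) = y)
    (a : Path.Homotopic.Quotient x y) (i : Fin (n + 2)) (q : Path y z)
    (hz : f (GeomSimplex.face n i (init n)) = z)
    (hq : ∀ t, q t = f (segment (init (n + 1)) (GeomSimplex.face n i (init n)) t)) :
    (of f hy a).face i = of (f.comp (GeomSimplex.face n i)) hz (a.trans (.mk q)) := by
  subst hy
  rw [of_rfl, ← of_self (LiftedSimplex.face _ i)]
  exact of_trans_mk_congr (f.comp (GeomSimplex.face n i)) rfl hz a
    ((segment _ _).map f.continuous) q fun t => (hq t).symm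

theorem _root_.GeomSimplex.face_apply (i : Fin (n + 2)) (t : GeomSimplex n) (j : Fin (n + 1)) :
    GeomSimplex.face n i t (i.succAbove j) = t j := by
  change stdSimplex.map i.succAbove t _ = _
  rw [stdSimplex.map_coe, FunOnFinite.linearMap_apply_apply]
  classical
  have : (Finset.univ.filter fun k => i.succAbove k = i.succAbove j) = {j} := by
    ext k; simp
  rw [this, Finset.sum_singleton]

theorem _root_.GeomSimplex.face_apply_self (i : Fin (n + 2)) (t : GeomSimplex n) :
    GeomSimplex.face n i t i = 0 := by
  change stdSimplex.map i.succAbove t _ = _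
  rw [stdSimplex.map_coe, FunOnFinite.linearMap_apply_apply]
  exact Finset.sum_eq_zero fun k hk => absurd (Finset.mem_filter.1 hk).2 (Fin.succAbove_ne i k)

theorem _root_.GeomSimplex.face_init_succ (i : Fin (n + 1)) :
    GeomSimplex.face n i.succ (init n) = init (n + 1) := by
  change stdSimplex.map _ _ = _
  rw [init, stdSimplex.map_vertex]
  simp [init]

theorem _root_.GeomSimplex.segment_self (p : GeomSimplex n) (t : unitInterval) :
    segment p p t = p :=
  Subtype.ext (AffineMap.lineMap_same_apply _ _)

/-- A face omitting a later vertex keeps the initial one, so the transporting segment is constant.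
-/
theorem face_succ_of (f : C(GeomSimplex (n + 1), X)) {y : X} (hy : f (init (n + 1)) = y)
    (a : Path.Homotopic.Quotient x y) (i : Fin (n + 1)) :
    (of f hy a).face i.succ = of (f.comp (GeomSimplex.face n i.succ))
      ((congrArg f (face_init_succ i)).trans hy) a := by
  rw [face_of f hy a i.succ (Path.refl y) ((congrArg f (face_init_succ i)).trans hy),
    Path.Homotopic.Quotient.mk_refl, Path.Homotopic.Quotient.trans_refl]
  intro t
  rw [face_init_succ, segment_self, hy]
  rfl

theorem _root_.GeomSimplex.homotopic {p q : GeomSimplex n} (a b : Path p q) : a.Homotopic b := by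
  have : ContractibleSpace (GeomSimplex n) :=
    (convex_stdSimplex ℝ (Fin (n + 1))).contractibleSpace ⟨_, (init n).2⟩
  exact SimplyConnectedSpace.paths_homotopic a b

/-- The two iterated faces move the initial vertex along different broken lines in the simplex;
these are homotopic because the simplex is contractible. -/
theorem face_face (s : LiftedSimplex X x (n + 2)) (i : Fin (n + 3)) (j : Fin (n + 2))
    (i' : Fin (n + 3)) (j' : Fin (n + 2))
    (h : (GeomSimplex.face (n + 1) i).comp (GeomSimplex.face n j) =
      (GeomSimplex.face (n + 1) i').comp (GeomSimplex.face n j')) :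
    (s.face i).face j = (s.face i').face j' := by
  have key : ∀ (i : Fin (n + 3)) (j : Fin (n + 2)), ∃ q : Path (init (n + 2))
      (((GeomSimplex.face (n + 1) i).comp (GeomSimplex.face n j)) (init n)),
      (s.face i).face j = ⟨s.toMap.comp ((GeomSimplex.face (n + 1) i).comp (GeomSimplex.face n j)),
        s.path.trans (.mk (q.map s.toMap.continuous))⟩ := by
    intro i j
    refine ⟨(segment _ (GeomSimplex.face (n + 1) i (init (n + 1)))).trans
      ((segment (init (n + 1)) (GeomSimplex.face n j (init n))).map
        (GeomSimplex.face (n + 1) i).continuous), ?_⟩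
    rw [Path.map_trans, Path.Homotopic.Quotient.mk_trans, ← Path.Homotopic.Quotient.trans_assoc]
    rfl
  obtain ⟨q, hq⟩ := key i j
  obtain ⟨q', hq'⟩ := key i' j'
  rw [hq, hq']
  clear hq hq' key
  revert q q'
  rw [h]
  intro q q'
  rw [Path.Homotopic.Quotient.eq.2 ((homotopic q q').map s.toMap)]

/-- The lifted vertex with endpoint class `a`. -/
def vertex {y : X} (a : Path.Homotopic.Quotient x y) : LiftedSimplex X x 0 :=
  of (ContinuousMap.const _ y) rfl a

theorem vertex_eq {y : X} (a : Path.Homotopic.Quotient x y) :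
    vertex a = ⟨ContinuousMap.const _ y, a⟩ := of_rfl (ContinuousMap.const _ y) a

theorem of_eq_vertex (f : C(GeomSimplex 0, X)) {y : X} (hy : f (init 0) = y)
    (a : Path.Homotopic.Quotient x y) : of f hy a = vertex a := by
  refine of_congr (ContinuousMap.ext fun t => ?_) _ _ a
  rw [Subsingleton.elim t (init 0), hy]; rfl

/-- The singular `1`-simplex of a path. -/
def edgeMap {y z : X} (b : Path y z) : C(GeomSimplex 1, X) where
  toFun t := b.extend (t 1)
  continuous_toFun := b.continuous_extend.comp ((continuous_apply 1).comp continuous_subtype_val)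

theorem edgeMap_apply {y z : X} (b : Path y z) (t : GeomSimplex 1) :
    edgeMap b t = b ⟨t 1, stdSimplex.zero_le t 1, stdSimplex.le_one t 1⟩ :=
  Path.extend_apply b _

theorem init_apply_ne {i : Fin (n + 1)} (hi : i ≠ 0) : init n i = 0 := by
  change (stdSimplex.vertex (S := ℝ) (0 : Fin (n + 1))) i = 0
  rw [stdSimplex.vertex_coe]
  simp [hi]

theorem edgeMap_init {y z : X} (b : Path y z) : edgeMap b (init 1) = y := by
  change b.extend (init 1 1) = y
  rw [init_apply_ne one_ne_zero, Path.extend_zero]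

/-- The lifted `1`-simplex of a path `b`, starting at the class `a`. -/
def edge {y z : X} (a : Path.Homotopic.Quotient x y) (b : Path y z) : LiftedSimplex X x 1 :=
  of (edgeMap b) (edgeMap_init b) a

theorem act_edge {y z : X} (a : Path.Homotopic.Quotient x y) (b : Path y z)
    (γ : FundamentalGroup X x) :
    (edge a b).act γ = edge ((FundamentalGroup.toPath γ).symm.trans a) b :=
  act_of _ _ _ _

theorem act_vertex {y : X} (a : Path.Homotopic.Quotient x y) (γ : FundamentalGroup X x) :
    (vertex a).act γ = vertex ((FundamentalGroup.toPath γ).symm.trans a) :=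
  act_of _ _ _ _

theorem segment_apply (p q : GeomSimplex n) (t : unitInterval) (j : Fin (n + 1)) :
    segment p q t j = (1 - (t : ℝ)) * p j + t * q j := by
  change AffineMap.lineMap (p : Fin (n + 1) → ℝ) (q : Fin (n + 1) → ℝ) (t : ℝ) j = _
  rw [AffineMap.lineMap_apply_module]
  rfl

theorem init_apply_zero : init n 0 = 1 := by
  change (stdSimplex.vertex (S := ℝ) (0 : Fin (n + 1))) 0 = 1
  rw [stdSimplex.vertex_coe]
  simp

theorem edge_face_zero {y z : X} (a : Path.Homotopic.Quotient x y) (b : Path y z) :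
    (edge a b).face 0 = vertex (a.trans (.mk b)) := by
  have h1 : GeomSimplex.face 0 0 (init 0) 1 = 1 :=
    (GeomSimplex.face_apply (0 : Fin 2) (init 0) 0).trans init_apply_zero
  rw [edge, face_of (edgeMap b) (edgeMap_init b) a 0 b, of_eq_vertex]
  · change b.extend _ = z
    rw [h1, Path.extend_one]
  · intro t
    change b t = b.extend _
    rw [segment_apply, h1, init_apply_ne one_ne_zero, mul_zero, zero_add, mul_one,
      Path.extend_apply]

theorem edge_face_one {y z : X} (a : Path.Homotopic.Quotient x y) (b : Path y z) :
    (edge a b).face 1 = vertex a := by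
  rw [edge, show (1 : Fin 2) = Fin.succ 0 from rfl, face_succ_of, of_eq_vertex]

/-- The coordinate `t 1` identifies `Δ¹` with the unit interval, so a singular `1`-simplex is the
same as a path. -/
theorem eq_edge (s : LiftedSimplex X x 1) :
    ∃ (y z : X) (a : Path.Homotopic.Quotient x y) (b : Path y z), s = edge a b := by
  refine ⟨_, _, s.path, (segment (init 1) (stdSimplex.vertex 1)).map s.toMap.continuous, ?_⟩
  refine (of_self s).symm.trans (of_congr (ContinuousMap.ext fun t => ?_) _ _ s.path)
  have ht : t 1 ∈ unitInterval := ⟨stdSimplex.zero_le t 1, stdSimplex.le_one t 1⟩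
  rw [edgeMap_apply]
  refine congrArg s.toMap (stdSimplex.ext (funext fun j => ?_))
  change t j = segment (init 1) (stdSimplex.vertex 1) ⟨t 1, ht⟩ j
  have h0 : t 0 = 1 - t 1 := eq_sub_of_add_eq (stdSimplex.add_eq_one t)
  rw [segment_apply]
  fin_cases j
  · change t 0 = (1 - t 1) * init 1 0 + t 1 * (stdSimplex.vertex (S := ℝ) (1 : Fin 2)) 0
    rw [init_apply_zero, stdSimplex.vertex_coe, h0]; simp
  · change t 1 = (1 - t 1) * init 1 1 + t 1 * (stdSimplex.vertex (S := ℝ) (1 : Fin 2)) 1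
    rw [init_apply_ne one_ne_zero, stdSimplex.vertex_coe]; simp

end LiftedSimplex
end

/-! ### Edges modulo boundaries: triangles, concatenation and homotopy -/

noncomputable section

namespace LiftedSimplex

open GeomSimplex

variable {X : Type u} [TopologicalSpace X] {x : X}

theorem exists_triangle (f : C(GeomSimplex 2, X)) {y₀ y₁ y₂ : X}
    (a : Path.Homotopic.Quotient x y₀) (b₀₁ : Path y₀ y₁) (b₁₂ : Path y₁ y₂) (b₀₂ : Path y₀ y₂)
    (h₀₁ : f.comp (GeomSimplex.face 1 2) = edgeMap b₀₁)
    (h₁₂ : f.comp (GeomSimplex.face 1 0) = edgeMap b₁₂)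
    (h₀₂ : f.comp (GeomSimplex.face 1 1) = edgeMap b₀₂) :
    ∃ s : LiftedSimplex X x 2, s.face 0 = edge (a.trans (.mk b₀₁)) b₁₂ ∧
      s.face 1 = edge a b₀₂ ∧ s.face 2 = edge a b₀₁ := by
  have hy : f (init 2) = y₀ := by
    rw [← edgeMap_init b₀₁, ← h₀₁]
    exact congrArg f (face_init_succ (1 : Fin 2)).symm
  refine ⟨of f hy a, ?_, (face_succ_of f hy a 0).trans (of_congr h₀₂ _ _ a),
    (face_succ_of f hy a 1).trans (of_congr h₀₁ _ _ a)⟩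
  have hz : f (GeomSimplex.face 1 0 (init 1)) = y₁ := by
    rw [← edgeMap_init b₁₂, ← h₁₂]; rfl
  rw [face_of f hy a 0 b₀₁ hz, edge]
  · exact of_congr h₁₂ _ _ _
  · intro t
    -- The segment transporting the initial vertex to the face opposite it is the edge from vertex
    -- `0` to vertex `1`, on which `f` is `b₀₁`.
    have h : segment (init 2) (GeomSimplex.face 1 0 (init 1)) t =
        GeomSimplex.face 1 2 (segment (init 1) (stdSimplex.vertex 1) t) := by
      refine stdSimplex.ext (funext fun j => ?_)
      have e1 : GeomSimplex.face 1 0 (init 1) 1 = 1 :=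
        (face_apply (0 : Fin 3) (init 1) 0).trans init_apply_zero
      have e2 : GeomSimplex.face 1 0 (init 1) 2 = 0 :=
        (face_apply (0 : Fin 3) (init 1) 1).trans (init_apply_ne one_ne_zero)
      have v0 : (stdSimplex.vertex (S := ℝ) (1 : Fin 2)) 0 = 0 := by
        rw [stdSimplex.vertex_coe]; simp
      have v1 : (stdSimplex.vertex (S := ℝ) (1 : Fin 2)) 1 = 1 := by
        rw [stdSimplex.vertex_coe]; simp
      fin_cases j
      · change segment _ _ t 0 = GeomSimplex.face 1 2 _ 0
        rw [show GeomSimplex.face 1 2 (segment (init 1) (stdSimplex.vertex 1) t) 0 = _ from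
          face_apply (2 : Fin 3) _ 0, segment_apply, segment_apply, init_apply_zero,
          init_apply_zero, face_apply_self, v0]
      · change segment _ _ t 1 = GeomSimplex.face 1 2 _ 1
        rw [show GeomSimplex.face 1 2 (segment (init 1) (stdSimplex.vertex 1) t) 1 = _ from
          face_apply (2 : Fin 3) _ 1, segment_apply, segment_apply, init_apply_ne one_ne_zero,
          init_apply_ne one_ne_zero, e1, v1]
      · change segment _ _ t 2 = GeomSimplex.face 1 2 _ 2
        rw [face_apply_self, segment_apply, e2, init_apply_ne (by decide)]
        simp
    rw [h]
    change _ = (f.comp (GeomSimplex.face 1 2)) _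
    rw [h₀₁, edgeMap_apply]
    congr 1
    refine Subtype.ext ?_
    change (t : ℝ) = segment (init 1) (stdSimplex.vertex 1) t 1
    rw [segment_apply, init_apply_ne one_ne_zero, stdSimplex.vertex_coe]
    simp

end LiftedSimplex

namespace TwistedHomology

open LiftedSimplex

variable {X : Type u} [TopologicalSpace X] {x : X} {R : Type v} [CommRing R]
  (φ : MonoidAlgebra ℤ (FundamentalGroup X x) →+* R)

/-- The twisted chain of a simplex. -/
def ofSimplex {n : ℕ} (s : LiftedSimplex X x n) : Chain φ n :=
  (relations φ n).mkQ (Finsupp.single s 1)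

theorem ofSimplex_act {n : ℕ} (s : LiftedSimplex X x n) (γ : FundamentalGroup X x) :
    ofSimplex φ (s.act γ) = φ (MonoidAlgebra.of ℤ _ γ) • ofSimplex φ s := by
  rw [ofSimplex, ofSimplex, ← map_smul, ← sub_eq_zero, ← map_sub, Submodule.mkQ_apply,
    Submodule.Quotient.mk_eq_zero, Finsupp.smul_single, smul_eq_mul, mul_one]
  exact Submodule.subset_span ⟨s, γ, rfl⟩

theorem chain_hom_ext {n : ℕ} {N : Type*} [AddCommGroup N] [Module R N]
    {f g : Chain φ n →ₗ[R] N} (h : ∀ s, f (ofSimplex φ s) = g (ofSimplex φ s)) : f = g := by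
  refine Submodule.linearMap_qext _ (Finsupp.lhom_ext' fun s => LinearMap.ext_ring ?_)
  exact h s

theorem freeBoundary_single {n : ℕ} (s : LiftedSimplex X x (n + 1)) :
    freeBoundary X x R n (Finsupp.single s 1) =
      ∑ i : Fin (n + 2), ((-1 : R) ^ (i : ℕ)) • Finsupp.single (s.face i) 1 := by
  rw [freeBoundary, Finsupp.lsum_single]
  simp only [LinearMap.sum_apply, LinearMap.smul_apply, Finsupp.lsingle_apply]

theorem boundary_ofSimplex {n : ℕ} (s : LiftedSimplex X x (n + 1)) :
    boundary φ n (ofSimplex φ s) =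
      ∑ i : Fin (n + 2), ((-1 : R) ^ (i : ℕ)) • ofSimplex φ (s.face i) := by
  rw [ofSimplex, Submodule.mkQ_apply, boundary, Submodule.mapQ_apply, freeBoundary_single,
    ← Submodule.mkQ_apply, map_sum]
  rfl

theorem boundary_zero_ofSimplex (s : LiftedSimplex X x 1) :
    boundary φ 0 (ofSimplex φ s) = ofSimplex φ (s.face 0) - ofSimplex φ (s.face 1) := by
  rw [boundary_ofSimplex, Fin.sum_univ_two]
  simp [sub_eq_add_neg]

theorem boundary_one_ofSimplex (s : LiftedSimplex X x 2) :
    boundary φ 1 (ofSimplex φ s) =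
      ofSimplex φ (s.face 0) - ofSimplex φ (s.face 1) + ofSimplex φ (s.face 2) := by
  rw [boundary_ofSimplex, Fin.sum_univ_three]
  simp [sub_eq_add_neg]

/-- Twisted one-chains modulo boundaries. -/
abbrev OneChainQuot : Type (max u v) := Chain φ 1 ⧸ LinearMap.range (boundary φ 1)

/-- The class modulo boundaries of the lift of a path. -/
def edgeClass {y z : X} (a : Path.Homotopic.Quotient x y) (b : Path y z) : OneChainQuot φ :=
  (LinearMap.range (boundary φ 1)).mkQ (ofSimplex φ (edge a b))

theorem edgeClass_triangle (f : C(GeomSimplex 2, X)) {y₀ y₁ y₂ : X}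
    (a : Path.Homotopic.Quotient x y₀) (b₀₁ : Path y₀ y₁) (b₁₂ : Path y₁ y₂) (b₀₂ : Path y₀ y₂)
    (h₀₁ : f.comp (GeomSimplex.face 1 2) = edgeMap b₀₁)
    (h₁₂ : f.comp (GeomSimplex.face 1 0) = edgeMap b₁₂)
    (h₀₂ : f.comp (GeomSimplex.face 1 1) = edgeMap b₀₂) :
    edgeClass φ a b₀₂ = edgeClass φ a b₀₁ + edgeClass φ (a.trans (.mk b₀₁)) b₁₂ := by
  obtain ⟨s, hs0, hs1, hs2⟩ := exists_triangle f a b₀₁ b₁₂ b₀₂ h₀₁ h₁₂ h₀₂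
  have h := boundary_one_ofSimplex φ s
  have h0 : (LinearMap.range (boundary φ 1)).mkQ (boundary φ 1 (ofSimplex φ s)) = 0 :=
    (Submodule.Quotient.mk_eq_zero _).2 (LinearMap.mem_range_self _ _)
  rw [h, hs0, hs1, hs2, map_add, map_sub] at h0
  change edgeClass φ _ b₁₂ - edgeClass φ a b₀₂ + edgeClass φ a b₀₁ = 0 at h0
  rw [← sub_eq_zero, ← neg_eq_zero, ← h0]
  abel

/-- A constant triangle gives `e = e + e`. -/
theorem edgeClass_refl {y : X} (a : Path.Homotopic.Quotient x y) :
    edgeClass φ a (Path.refl y) = 0 := by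
  have hc : ∀ i, (ContinuousMap.const (GeomSimplex 2) y).comp (GeomSimplex.face 1 i) =
      edgeMap (Path.refl y) := fun i => by
    ext t
    rw [edgeMap_apply]; rfl
  have h := edgeClass_triangle φ (ContinuousMap.const _ y) a (Path.refl y) (Path.refl y)
    (Path.refl y) (hc _) (hc _) (hc _)
  rw [Path.Homotopic.Quotient.mk_refl, Path.Homotopic.Quotient.trans_refl] at h
  exact left_eq_add.1 h

theorem _root_.GeomSimplex.continuous_coord {n : ℕ} (i : Fin (n + 1)) :
    Continuous fun t : GeomSimplex n => t i :=
  (continuous_apply i).comp continuous_subtype_val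

theorem _root_.GeomSimplex.face_coords (t : GeomSimplex 1) :
    (GeomSimplex.face 1 0 t 1 = t 0 ∧ GeomSimplex.face 1 0 t 2 = t 1) ∧
    (GeomSimplex.face 1 1 t 1 = 0 ∧ GeomSimplex.face 1 1 t 2 = t 1) ∧
    (GeomSimplex.face 1 2 t 1 = t 1 ∧ GeomSimplex.face 1 2 t 2 = 0) :=
  ⟨⟨GeomSimplex.face_apply 0 t 0, GeomSimplex.face_apply 0 t 1⟩,
    ⟨GeomSimplex.face_apply_self 1 t, GeomSimplex.face_apply 1 t 1⟩,
    ⟨GeomSimplex.face_apply 2 t 1, GeomSimplex.face_apply_self 2 t⟩⟩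

theorem edgeClass_trans {y z w : X} (a : Path.Homotopic.Quotient x y) (b : Path y z)
    (c : Path z w) :
    edgeClass φ a (b.trans c) = edgeClass φ a b + edgeClass φ (a.trans (.mk b)) c := by
  -- The triangle is collapsed onto the path by the affine function with values `0`, `1/2`, `1` at
  -- the vertices.
  refine edgeClass_triangle φ ⟨fun t : GeomSimplex 2 => (b.trans c).extend (t 1 / 2 + t 2),
    (b.trans c).continuous_extend.comp (((GeomSimplex.continuous_coord 1).div_const 2).add
      (GeomSimplex.continuous_coord 2))⟩ a b c (b.trans c) ?_ ?_ ?_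
  all_goals
    ext t
    obtain ⟨⟨f1, f2⟩, ⟨f3, f4⟩, f5, f6⟩ := GeomSimplex.face_coords t
    have ht0 := stdSimplex.zero_le t 1
    have ht1 := stdSimplex.le_one t 1
    have ht : t 0 = 1 - t 1 := eq_sub_of_add_eq (stdSimplex.add_eq_one t)
    rw [edgeMap_apply]
  · change (b.trans c).extend (GeomSimplex.face 1 2 t 1 / 2 + GeomSimplex.face 1 2 t 2) = _
    rw [f5, f6, Path.extend_apply _ ⟨by linarith, by linarith⟩, Path.trans_apply, dif_pos]
    · congr 1; refine Subtype.ext ?_; change 2 * (t 1 / 2 + 0) = t 1; ring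
    · change t 1 / 2 + 0 ≤ 1 / 2; linarith
  · change (b.trans c).extend (GeomSimplex.face 1 0 t 1 / 2 + GeomSimplex.face 1 0 t 2) = _
    rw [f1, f2, ht, Path.extend_apply _ ⟨by linarith, by linarith⟩, Path.trans_apply]
    split_ifs with h
    -- On this edge the first half of the concatenation is met only at the junction, where both
    -- branches give `z`.
    · change (1 - t 1) / 2 + t 1 ≤ 1 / 2 at h
      have h0 : t 1 = 0 := by linarith
      have e1 : (⟨2 * ((1 - t 1) / 2 + t 1), by constructor <;> linarith⟩ : unitInterval) = 1 :=
        Subtype.ext (by change 2 * ((1 - t 1) / 2 + t 1) = 1; linarith)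
      have e2 : (⟨t 1, ht0, ht1⟩ : unitInterval) = 0 := Subtype.ext h0
      rw [e2, c.source]
      exact (congrArg b e1).trans b.target
    · congr 1; refine Subtype.ext ?_; change 2 * ((1 - t 1) / 2 + t 1) - 1 = t 1; ring
  · change (b.trans c).extend (GeomSimplex.face 1 1 t 1 / 2 + GeomSimplex.face 1 1 t 2) = _
    rw [f3, f4, zero_div, zero_add]
    exact Path.extend_apply _ ⟨ht0, ht1⟩

/-- The square of the homotopy is cut along its diagonal. Each triangle has the diagonal, one of the
two paths and a constant edge as sides. -/
theorem edgeClass_homotopic {y z : X} (a : Path.Homotopic.Quotient x y) {b b' : Path y z}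
    (h : b.Homotopic b') : edgeClass φ a b = edgeClass φ a b' := by
  obtain ⟨H⟩ := h
  -- Clamping extends the homotopy to the plane, so that affine expressions in the barycentric
  -- coordinates can be substituted freely.
  let F : ℝ × ℝ → X := fun p => H (Set.projIcc 0 1 zero_le_one p.1, Set.projIcc 0 1 zero_le_one p.2)
  have hF : Continuous F := H.continuous.comp
    ((continuous_projIcc.comp continuous_fst).prodMk (continuous_projIcc.comp continuous_snd))
  let diag : Path y z :=
    { toFun := fun t => H (t, t)
      continuous_toFun := H.continuous.comp (continuous_id.prodMk continuous_id)
      source' := H.source 0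
      target' := H.target 1 }
  have hval : ∀ (t : GeomSimplex 1) (r : ℝ), r = t 1 → Set.projIcc (0 : ℝ) 1 zero_le_one r =
      ⟨t 1, stdSimplex.zero_le t 1, stdSimplex.le_one t 1⟩ := fun t r hr => by
    subst hr; exact Set.projIcc_of_mem _ _
  have h0 : Set.projIcc (0 : ℝ) 1 zero_le_one 0 = 0 := Set.projIcc_left _
  have h1 : Set.projIcc (0 : ℝ) 1 zero_le_one 1 = 1 := Set.projIcc_right _
  have c1 := GeomSimplex.continuous_coord (1 : Fin 3)
  have c2 := GeomSimplex.continuous_coord (2 : Fin 3)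
  have e1 : edgeClass φ a diag = edgeClass φ a b + edgeClass φ (a.trans (.mk b)) (Path.refl z) := by
    -- The vertices go to `(0,0)`, `(0,1)`, `(1,1)`, the first coordinate being the homotopy
    -- parameter.
    refine edgeClass_triangle φ ⟨fun t : GeomSimplex 2 => F (t 2, t 1 + t 2),
      hF.comp (c2.prodMk (c1.add c2))⟩ a b (Path.refl z) diag ?_ ?_ ?_
    all_goals
      ext t
      obtain ⟨⟨f1, f2⟩, ⟨f3, f4⟩, f5, f6⟩ := GeomSimplex.face_coords t
      have ht : t 0 = 1 - t 1 := eq_sub_of_add_eq (stdSimplex.add_eq_one t)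
      rw [edgeMap_apply]
    · change H (Set.projIcc 0 1 _ (GeomSimplex.face 1 2 t 2),
        Set.projIcc 0 1 _ (GeomSimplex.face 1 2 t 1 + GeomSimplex.face 1 2 t 2)) = _
      rw [f5, f6, h0, hval t _ (add_zero _)]
      exact H.apply_zero _
    · change H (Set.projIcc 0 1 _ (GeomSimplex.face 1 0 t 2),
        Set.projIcc 0 1 _ (GeomSimplex.face 1 0 t 1 + GeomSimplex.face 1 0 t 2)) = _
      rw [f1, f2, ht, sub_add_cancel, h1]
      exact H.target _
    · change H (Set.projIcc 0 1 _ (GeomSimplex.face 1 1 t 2),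
        Set.projIcc 0 1 _ (GeomSimplex.face 1 1 t 1 + GeomSimplex.face 1 1 t 2)) = _
      rw [f3, f4, hval t _ rfl, hval t _ (zero_add _)]
      rfl
  have e2 : edgeClass φ a diag =
      edgeClass φ a (Path.refl y) + edgeClass φ (a.trans (.mk (Path.refl y))) b' := by
    -- The other half of the square: `(0,0)`, `(1,0)`, `(1,1)`.
    refine edgeClass_triangle φ ⟨fun t : GeomSimplex 2 => F (t 1 + t 2, t 2),
      hF.comp ((c1.add c2).prodMk c2)⟩ a (Path.refl y) b' diag ?_ ?_ ?_
    all_goals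
      ext t
      obtain ⟨⟨f1, f2⟩, ⟨f3, f4⟩, f5, f6⟩ := GeomSimplex.face_coords t
      have ht : t 0 = 1 - t 1 := eq_sub_of_add_eq (stdSimplex.add_eq_one t)
      rw [edgeMap_apply]
    · change H (Set.projIcc 0 1 _ (GeomSimplex.face 1 2 t 1 + GeomSimplex.face 1 2 t 2),
        Set.projIcc 0 1 _ (GeomSimplex.face 1 2 t 2)) = _
      rw [f5, f6, h0]
      exact H.source _
    · change H (Set.projIcc 0 1 _ (GeomSimplex.face 1 0 t 1 + GeomSimplex.face 1 0 t 2),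
        Set.projIcc 0 1 _ (GeomSimplex.face 1 0 t 2)) = _
      rw [f1, f2, ht, sub_add_cancel, h1, hval t _ rfl]
      exact H.apply_one _
    · change H (Set.projIcc 0 1 _ (GeomSimplex.face 1 1 t 1 + GeomSimplex.face 1 1 t 2),
        Set.projIcc 0 1 _ (GeomSimplex.face 1 1 t 2)) = _
      rw [f3, f4, hval t _ (zero_add _), hval t _ rfl]
      rfl
  rw [edgeClass_refl, add_zero] at e1
  rw [edgeClass_refl, zero_add, Path.Homotopic.Quotient.mk_refl,
    Path.Homotopic.Quotient.trans_refl] at e2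
  exact e1.symm.trans e2

end TwistedHomology
end

/-! ### Comparison of twisted one-cycles with the Alexander module -/

noncomputable section

namespace TwistedHomology

open LiftedSimplex

variable {X : Type u} [TopologicalSpace X] {x : X} {R : Type v} [CommRing R]
  (φ : MonoidAlgebra ℤ (FundamentalGroup X x) →+* R)

theorem freeBoundary_zero_single (s : LiftedSimplex X x 1) :
    freeBoundary X x R 0 (Finsupp.single s 1) =
      Finsupp.single (s.face 0) 1 - Finsupp.single (s.face 1) 1 := by
  rw [freeBoundary_single, Fin.sum_univ_two, sub_eq_add_neg]
  simp

theorem freeBoundary_one_single (s : LiftedSimplex X x 2) :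
    freeBoundary X x R 1 (Finsupp.single s 1) =
      Finsupp.single (s.face 0) 1 - Finsupp.single (s.face 1) 1 +
        Finsupp.single (s.face 2) 1 := by
  rw [freeBoundary_single, Fin.sum_univ_three, sub_eq_add_neg]
  simp

theorem freeBoundary_freeBoundary (s : LiftedSimplex X x 2) :
    freeBoundary X x R 0 (freeBoundary X x R 1 (Finsupp.single s 1)) = 0 := by
  have e01 : (s.face 0).face 0 = (s.face 1).face 0 := by
    refine face_face s 0 0 1 0 (ContinuousMap.ext fun t => ?_)
    change stdSimplex.map _ (stdSimplex.map _ t) = stdSimplex.map _ (stdSimplex.map _ t)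
    rw [stdSimplex.map_comp_apply, stdSimplex.map_comp_apply]
    congr 1
  have e02 : (s.face 0).face 1 = (s.face 2).face 0 := by
    refine face_face s 0 1 2 0 (ContinuousMap.ext fun t => ?_)
    change stdSimplex.map _ (stdSimplex.map _ t) = stdSimplex.map _ (stdSimplex.map _ t)
    rw [stdSimplex.map_comp_apply, stdSimplex.map_comp_apply]
    congr 1
    decide
  have e12 : (s.face 1).face 1 = (s.face 2).face 1 := by
    refine face_face s 1 1 2 1 (ContinuousMap.ext fun t => ?_)
    change stdSimplex.map _ (stdSimplex.map _ t) = stdSimplex.map _ (stdSimplex.map _ t)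
    rw [stdSimplex.map_comp_apply, stdSimplex.map_comp_apply]
    congr 1
    decide
  simp only [freeBoundary_one_single, map_add, map_sub, freeBoundary_zero_single, e01, e02, e12]
  abel

theorem boundary_boundary (c : Chain φ 2) : boundary φ 0 (boundary φ 1 c) = 0 := by
  suffices h : (boundary φ 0).comp (boundary φ 1) = 0 from LinearMap.congr_fun h c
  refine chain_hom_ext φ fun s => ?_
  change (relations φ 0).mkQ (freeBoundary X x R 0 (freeBoundary X x R 1 (Finsupp.single s 1))) = 0
  rw [freeBoundary_freeBoundary, map_zero]

/-- The boundary map on one-chains modulo boundaries. -/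
def quotBoundary : OneChainQuot φ →ₗ[R] Chain φ 0 :=
  (LinearMap.range (boundary φ 1)).liftQ (boundary φ 0) <| by
    rintro _ ⟨c, rfl⟩
    exact boundary_boundary φ c

theorem quotBoundary_edgeClass {y z : X} (a : Path.Homotopic.Quotient x y) (b : Path y z) :
    quotBoundary φ (edgeClass φ a b) =
      ofSimplex φ (vertex (a.trans (.mk b))) - ofSimplex φ (vertex a) := by
  change boundary φ 0 (ofSimplex φ (edge a b)) = _
  rw [boundary_zero_ofSimplex, edge_face_zero, edge_face_one]

theorem quot_hom_ext {N : Type*} [AddCommGroup N] [Module R N] {f g : OneChainQuot φ →ₗ[R] N}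
    (h : ∀ (y z : X) (a : Path.Homotopic.Quotient x y) (b : Path y z),
      f (edgeClass φ a b) = g (edgeClass φ a b)) : f = g := by
  refine Submodule.linearMap_qext _ (chain_hom_ext φ fun s => ?_)
  obtain ⟨y, z, a, b, rfl⟩ := eq_edge s
  exact h y z a b

/-- The class of the lift, starting at the base point, of a homotopy class of paths. -/
def pathClass {y : X} (q : Path.Homotopic.Quotient x y) : OneChainQuot φ :=
  Quotient.lift (edgeClass φ (.refl x)) (fun _ _ h => edgeClass_homotopic φ _ h) q

/-- Edges that start at the base point therefore generate all one-chains modulo boundaries. -/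
theorem edgeClass_eq_sub {y z : X} (a : Path.Homotopic.Quotient x y) (b : Path y z) :
    edgeClass φ a b = pathClass φ (a.trans (.mk b)) - pathClass φ a := by
  obtain ⟨a, rfl⟩ := Path.Homotopic.Quotient.mk_surjective a
  rw [← Path.Homotopic.Quotient.mk_trans]
  change _ = edgeClass φ (.refl x) (a.trans b) - edgeClass φ (.refl x) a
  rw [edgeClass_trans, Path.Homotopic.Quotient.refl_trans, add_sub_cancel_left]

/-- After the loop `γ⁻¹`, the lift of `q` continues as the `γ`-translate of the lift from the base
point. For loops this is the derivation rule. -/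
theorem pathClass_trans (γ : FundamentalGroup X x) {y : X} (q : Path.Homotopic.Quotient x y) :
    pathClass φ ((FundamentalGroup.toPath γ).symm.trans q) =
      pathClass φ (FundamentalGroup.toPath γ).symm +
        φ (MonoidAlgebra.of ℤ _ γ) • pathClass φ q := by
  obtain ⟨b, rfl⟩ := Path.Homotopic.Quotient.mk_surjective q
  have h := edgeClass_eq_sub φ (FundamentalGroup.toPath γ).symm b
  have h' : edgeClass φ (FundamentalGroup.toPath γ).symm b =
      φ (MonoidAlgebra.of ℤ _ γ) • pathClass φ (.mk b) := by
    change _ = _ • edgeClass φ (.refl x) b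
    rw [edgeClass, edgeClass, ← map_smul, ← ofSimplex_act, act_edge,
      Path.Homotopic.Quotient.trans_refl]
  rw [← h', h, add_sub_cancel]

theorem quotBoundary_pathClass {y : X} (q : Path.Homotopic.Quotient x y) :
    quotBoundary φ (pathClass φ q) =
      ofSimplex φ (vertex q) - ofSimplex φ (vertex (.refl x)) := by
  obtain ⟨b, rfl⟩ := Path.Homotopic.Quotient.mk_surjective q
  change quotBoundary φ (edgeClass φ (.refl x) b) = _
  rw [quotBoundary_edgeClass, Path.Homotopic.Quotient.refl_trans]

variable (P : FinGenPresentation (FundamentalGroup X x))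

/-- The class of a loop, as a linear map on the Alexander module. -/
def loopClass : P.FoxModule φ →ₗ[R] OneChainQuot φ :=
  P.foxLift φ (fun γ => pathClass φ (FundamentalGroup.toPath γ).symm) fun γ δ => by
    rw [← pathClass_trans]
    congr 1
    -- In the fundamental group `γ * δ` is the path `δ` followed by `γ`, so its inverse is `γ⁻¹`
    -- followed by `δ⁻¹`.
    exact mul_inv_rev γ δ

theorem loopClass_foxD (γ : FundamentalGroup X x) :
    loopClass φ P (P.foxD φ γ) = pathClass φ (FundamentalGroup.toPath γ).symm :=
  P.foxLift_foxD φ _ _ γ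

theorem quotBoundary_loopClass (α : P.FoxModule φ) :
    quotBoundary φ (loopClass φ P α) =
      P.foxBoundary φ α • ofSimplex φ (vertex (.refl x)) := by
  suffices h : (quotBoundary φ).comp (loopClass φ P) =
      (P.foxBoundary φ).smulRight (ofSimplex φ (vertex (.refl x))) from LinearMap.congr_fun h α
  refine P.foxModule_hom_ext φ fun γ => ?_
  rw [LinearMap.comp_apply, loopClass_foxD, quotBoundary_pathClass, LinearMap.smulRight_apply,
    P.foxBoundary_foxD, sub_smul, one_smul, ← ofSimplex_act, act_vertex,
    Path.Homotopic.Quotient.trans_refl]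

variable (p : ∀ y : X, Path.Homotopic.Quotient x y)

/-- The element of the group by which a class of paths differs from the chosen one. -/
def deck {y : X} (a : Path.Homotopic.Quotient x y) : FundamentalGroup X x :=
  FundamentalGroup.fromPath ((p y).trans a.symm)

theorem deck_act {y : X} (a : Path.Homotopic.Quotient x y) (γ : FundamentalGroup X x) :
    deck p ((FundamentalGroup.toPath γ).symm.trans a) = γ * deck p a := by
  obtain ⟨b, rfl⟩ := Path.Homotopic.Quotient.mk_surjective a
  obtain ⟨c, rfl⟩ := Path.Homotopic.Quotient.mk_surjective γ
  change (p y).trans _ = ((p y).trans _).trans _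
  rw [Path.Homotopic.Quotient.trans_assoc]
  congr 1
  rw [← Path.Homotopic.Quotient.mk_symm, ← Path.Homotopic.Quotient.mk_symm,
    ← Path.Homotopic.Quotient.mk_trans, ← Path.Homotopic.Quotient.mk_symm,
    ← Path.Homotopic.Quotient.mk_trans, Path.trans_symm, Path.symm_symm]

theorem deck_symm_trans {y : X} (a : Path.Homotopic.Quotient x y) :
    (FundamentalGroup.toPath (deck p a)).symm.trans (p y) = a := by
  obtain ⟨b, rfl⟩ := Path.Homotopic.Quotient.mk_surjective a
  obtain ⟨c, hc⟩ := Path.Homotopic.Quotient.mk_surjective (p y)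
  change ((p y).trans _).symm.trans (p y) = _
  rw [← hc, ← Path.Homotopic.Quotient.mk_symm, ← Path.Homotopic.Quotient.mk_trans,
    ← Path.Homotopic.Quotient.mk_symm, Path.trans_symm, Path.symm_symm,
    Path.Homotopic.Quotient.mk_trans, Path.Homotopic.Quotient.trans_assoc,
    Path.Homotopic.Quotient.mk_symm, Path.Homotopic.Quotient.symm_trans,
    Path.Homotopic.Quotient.trans_refl]

theorem deck_symm_loop (hp : p x = .refl x) (γ : FundamentalGroup X x) :
    deck p (FundamentalGroup.toPath γ).symm = γ := by
  obtain ⟨c, rfl⟩ := Path.Homotopic.Quotient.mk_surjective γ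
  change (p x).trans _ = _
  rw [hp, Path.Homotopic.Quotient.refl_trans, ← Path.Homotopic.Quotient.mk_symm,
    ← Path.Homotopic.Quotient.mk_symm, Path.symm_symm]

/-- The label of a lifted vertex in the Alexander module. -/
def vertexLabel : (LiftedSimplex X x 0 →₀ R) →ₗ[R] P.FoxModule φ :=
  Finsupp.lsum R fun s => (LinearMap.toSpanSingleton R _ (P.foxD φ (deck p s.path)))

theorem vertexLabel_single {y : X} (a : Path.Homotopic.Quotient x y) (r : R) :
    vertexLabel φ P p (Finsupp.single (vertex a) r) = r • P.foxD φ (deck p a) := by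
  rw [vertexLabel, Finsupp.lsum_single, LinearMap.toSpanSingleton_apply, vertex_eq]
  rfl

/-- The one-chain complex of the universal covering, compared with the Alexander module. -/
def chainLabel : Chain φ 1 →ₗ[R] P.FoxModule φ :=
  (relations φ 1).liftQ ((vertexLabel φ P p).comp (freeBoundary X x R 0)) <| by
    refine Submodule.span_le.2 ?_
    rintro _ ⟨s, γ, rfl⟩
    obtain ⟨y, z, a, b, rfl⟩ := eq_edge s
    rw [SetLike.mem_coe, LinearMap.mem_ker, LinearMap.comp_apply, act_edge, map_sub,
      ← mul_one (φ _), ← smul_eq_mul, ← Finsupp.smul_single, map_smul, freeBoundary_zero_single,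
      freeBoundary_zero_single]
    -- Translating by `γ` adds the same term `foxD γ` at both endpoints. It cancels in the
    -- difference, so the label respects the relations on edges although it does not on single
    -- vertices.
    simp only [edge_face_zero, edge_face_one, map_sub, map_smul, vertexLabel_single,
      Path.Homotopic.Quotient.trans_assoc, deck_act, P.foxD_mul, one_smul, smul_sub]
    abel

theorem chainLabel_edge {y z : X} (a : Path.Homotopic.Quotient x y) (b : Path y z) :
    chainLabel φ P p (ofSimplex φ (edge a b)) =
      P.foxD φ (deck p (a.trans (.mk b))) - P.foxD φ (deck p a) := by
  change vertexLabel φ P p (freeBoundary X x R 0 (Finsupp.single (edge a b) 1)) = _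
  rw [freeBoundary_zero_single, map_sub, edge_face_zero, edge_face_one, vertexLabel_single,
    vertexLabel_single, one_smul, one_smul]

theorem chainLabel_boundary (c : Chain φ 2) : chainLabel φ P p (boundary φ 1 c) = 0 := by
  suffices h : (chainLabel φ P p).comp (boundary φ 1) = 0 from LinearMap.congr_fun h c
  refine chain_hom_ext φ fun s => ?_
  change vertexLabel φ P p (freeBoundary X x R 0 (freeBoundary X x R 1 (Finsupp.single s 1))) = 0
  rw [freeBoundary_freeBoundary, map_zero]

/-- The map induced by `chainLabel` modulo boundaries. -/
def quotLabel : OneChainQuot φ →ₗ[R] P.FoxModule φ :=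
  (LinearMap.range (boundary φ 1)).liftQ (chainLabel φ P p) <| by
    rintro _ ⟨c, rfl⟩
    exact chainLabel_boundary φ P p c

theorem quotLabel_edgeClass {y z : X} (a : Path.Homotopic.Quotient x y) (b : Path y z) :
    quotLabel φ P p (edgeClass φ a b) =
      P.foxD φ (deck p (a.trans (.mk b))) - P.foxD φ (deck p a) :=
  chainLabel_edge φ P p a b

theorem quotLabel_loopClass (hp : p x = .refl x) (α : P.FoxModule φ) :
    quotLabel φ P p (loopClass φ P α) = α := by
  suffices h : (quotLabel φ P p).comp (loopClass φ P) = LinearMap.id from LinearMap.congr_fun h α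
  refine P.foxModule_hom_ext φ fun γ => ?_
  rw [LinearMap.comp_apply, loopClass_foxD, LinearMap.id_apply]
  obtain ⟨b, hb⟩ := Path.Homotopic.Quotient.mk_surjective (FundamentalGroup.toPath γ).symm
  have h1 : deck p (.refl x) = 1 := by
    have := deck_symm_loop p hp 1
    have e : (FundamentalGroup.toPath (1 : FundamentalGroup X x)).symm = .refl x :=
      inv_one (G := FundamentalGroup X x)
    rwa [e] at this
  have hd1 : P.foxD φ 1 = 0 := by
    have := P.foxD_mul φ 1 1
    rw [map_one, map_one, one_smul, mul_one] at this
    exact left_eq_add.1 this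
  rw [← hb]
  change quotLabel φ P p (edgeClass φ (.refl x) b) = _
  rw [quotLabel_edgeClass, Path.Homotopic.Quotient.refl_trans, hb, deck_symm_loop p hp, h1, hd1,
    sub_zero]

theorem foxBoundary_chainLabel (c : Chain φ 1) (hc : boundary φ 0 c = 0) :
    P.foxBoundary φ (chainLabel φ P p c) = 0 := by
  -- The augmentation sending a vertex to `φ` of its deck element. On an edge, `foxBoundary` of the
  -- label is the difference of two terms `φ(deck) - 1`, which is the augmentation of the boundary.
  let aug : Chain φ 0 →ₗ[R] R := (relations φ 0).liftQ
    (Finsupp.lsum R fun s => LinearMap.toSpanSingleton R R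
      (φ (MonoidAlgebra.of ℤ _ (deck p s.path)))) <| by
    refine Submodule.span_le.2 ?_
    rintro _ ⟨s, γ, rfl⟩
    rw [SetLike.mem_coe, LinearMap.mem_ker, map_sub, Finsupp.lsum_single, Finsupp.lsum_single,
      LinearMap.toSpanSingleton_apply, LinearMap.toSpanSingleton_apply]
    change 1 • φ (MonoidAlgebra.of ℤ _ (deck p ((FundamentalGroup.toPath γ).symm.trans s.path))) -
      _ = 0
    rw [deck_act, map_mul, map_mul, one_smul, smul_eq_mul, sub_self]
  have haug : ∀ {y : X} (a : Path.Homotopic.Quotient x y), aug (ofSimplex φ (vertex a)) =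
      φ (MonoidAlgebra.of ℤ _ (deck p a)) := fun a => by
    change Finsupp.lsum R _ (Finsupp.single (vertex a) 1) = _
    rw [Finsupp.lsum_single, LinearMap.toSpanSingleton_apply, one_smul, vertex_eq]
    rfl
  suffices h : (P.foxBoundary φ).comp (chainLabel φ P p) = aug.comp (boundary φ 0) by
    have := LinearMap.congr_fun h c
    rwa [LinearMap.comp_apply, LinearMap.comp_apply, hc, map_zero] at this
  refine chain_hom_ext φ fun s => ?_
  obtain ⟨y, z, a, b, rfl⟩ := eq_edge s
  rw [LinearMap.comp_apply, LinearMap.comp_apply, chainLabel_edge, boundary_zero_ofSimplex,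
    edge_face_zero, edge_face_one, map_sub, map_sub, haug, haug, P.foxBoundary_foxD,
    P.foxBoundary_foxD]
  ring

theorem loopClass_quotLabel (c : OneChainQuot φ) (hc : quotBoundary φ c = 0) :
    loopClass φ P (quotLabel φ P p c) = c := by
  -- A chain homotopy: a vertex is sent to the translate of the chosen path to its projection. It
  -- gives `loopClass ∘ quotLabel = id - h ∘ ∂`, which is the identity on cycles.
  let h : Chain φ 0 →ₗ[R] OneChainQuot φ := (relations φ 0).liftQ
    (Finsupp.lsum R fun s => LinearMap.toSpanSingleton R _
      (φ (MonoidAlgebra.of ℤ _ (deck p s.path)) •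
        pathClass φ (p (s.toMap (GeomSimplex.init 0))))) <| by
    refine Submodule.span_le.2 ?_
    rintro _ ⟨s, γ, rfl⟩
    rw [SetLike.mem_coe, LinearMap.mem_ker, map_sub, Finsupp.lsum_single, Finsupp.lsum_single,
      LinearMap.toSpanSingleton_apply, LinearMap.toSpanSingleton_apply]
    change (1 : R) • (φ (MonoidAlgebra.of ℤ _
      (deck p ((FundamentalGroup.toPath γ).symm.trans s.path))) •
        pathClass φ (p (s.toMap (GeomSimplex.init 0)))) - _ = 0
    rw [deck_act, map_mul, map_mul, one_smul, smul_smul, sub_self]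
  have hh : ∀ {y : X} (a : Path.Homotopic.Quotient x y), h (ofSimplex φ (vertex a)) =
      φ (MonoidAlgebra.of ℤ _ (deck p a)) • pathClass φ (p y) := fun a => by
    change Finsupp.lsum R _ (Finsupp.single (vertex a) 1) = _
    rw [Finsupp.lsum_single, LinearMap.toSpanSingleton_apply, one_smul, vertex_eq]
    rfl
  suffices e : (loopClass φ P).comp (quotLabel φ P p) =
      LinearMap.id - h.comp (quotBoundary φ) by
    have := LinearMap.congr_fun e c
    rwa [LinearMap.comp_apply, LinearMap.sub_apply, LinearMap.comp_apply, hc, map_zero, sub_zero,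
      LinearMap.id_apply] at this
  refine quot_hom_ext φ fun y z a b => ?_
  -- Every class `a` is the inverse of its deck loop followed by the chosen path.
  have key : ∀ {y : X} (a : Path.Homotopic.Quotient x y),
      pathClass φ (FundamentalGroup.toPath (deck p a)).symm =
        pathClass φ a - φ (MonoidAlgebra.of ℤ _ (deck p a)) • pathClass φ (p y) := fun {y} a => by
    have := pathClass_trans φ (deck p a) (p y)
    rw [deck_symm_trans] at this
    rw [this, add_sub_cancel_right]
  rw [LinearMap.comp_apply, quotLabel_edgeClass, map_sub, loopClass_foxD, loopClass_foxD,
    LinearMap.sub_apply, LinearMap.comp_apply, quotBoundary_edgeClass, map_sub, hh, hh,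
    LinearMap.id_apply, edgeClass_eq_sub, key, key]
  abel

/-- The first twisted homology of a path-connected space, computed from a presentation of its
fundamental group. -/
theorem nonempty_equiv_ker_foxBoundary [PathConnectedSpace X] :
    Nonempty (TwistedH1 φ ≃ₗ[R] LinearMap.ker (P.foxBoundary φ)) := by
  obtain ⟨p, hp⟩ : ∃ p : ∀ y : X, Path.Homotopic.Quotient x y, p x = .refl x :=
    -- The arbitrary path from `x` to `x` is divided out so that the chosen path at the base point
    -- is trivial.
    ⟨fun y => (Path.Homotopic.Quotient.mk (PathConnectedSpace.somePath x x)).symm.trans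
      (.mk (PathConnectedSpace.somePath x y)), Path.Homotopic.Quotient.symm_trans _⟩
  let f : LinearMap.ker (boundary φ 0) →ₗ[R] LinearMap.ker (P.foxBoundary φ) :=
    (chainLabel φ P p).restrict fun c hc => foxBoundary_chainLabel φ P p c hc
  have hf : Function.Surjective f := by
    rintro ⟨α, hα⟩
    obtain ⟨c, hc⟩ := Submodule.mkQ_surjective _ (loopClass φ P α)
    refine ⟨⟨c, ?_⟩, Subtype.ext ?_⟩
    · change quotBoundary φ (Submodule.mkQ _ c) = 0
      rw [hc, quotBoundary_loopClass, LinearMap.mem_ker.1 hα, zero_smul]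
    · change quotLabel φ P p (Submodule.mkQ _ c) = α
      rw [hc, quotLabel_loopClass φ P p hp]
  have hker : LinearMap.ker f =
      (LinearMap.range (boundary φ 1)).comap (LinearMap.ker (boundary φ 0)).subtype := by
    ext ⟨c, hc⟩
    constructor
    · intro h
      have h0 : quotLabel φ P p (Submodule.mkQ _ c) = 0 := congrArg Subtype.val h
      have := loopClass_quotLabel φ P p (Submodule.mkQ _ c) hc
      rw [h0, map_zero] at this
      exact (Submodule.Quotient.mk_eq_zero (LinearMap.range (boundary φ 1))).1 this.symm
    · rintro ⟨d, hd⟩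
      refine Subtype.ext ?_
      change chainLabel φ P p c = 0
      rw [show c = boundary φ 1 d from hd.symm, chainLabel_boundary]
  exact ⟨(Submodule.quotEquivOfEq _ _ hker.symm).trans (f.quotKerEquivOfSurjective hf)⟩

end TwistedHomology
end

noncomputable section

/-! ## Maximal minors over a principal ideal domain -/

section Minors

open Module
open scoped Pointwise

variable {R : Type u} [CommRing R]

/-- Modulo the ideal `J` of these determinants, `e.det` vanishes on tuples of generators, hence
everywhere by multilinearity; but its value on `e` is `1`. -/
theorem span_basis_det_eq_top {M : Type*} [AddCommGroup M] [Module R M] {ι κ : Type*}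
    [Fintype κ] [DecidableEq κ] (e : Basis κ R M) (g : ι → M)
    (hg : Submodule.span R (Set.range g) = ⊤) :
    Ideal.span {a | ∃ r : κ → ι, a = e.det fun i => g (r i)} = ⊤ := by
  set J := Ideal.span {a | ∃ r : κ → ι, a = e.det fun i => g (r i)} with hJ
  have h : (J.mkQ.compMultilinearMap e.det.toMultilinearMap) = 0 := by
    refine MultilinearMap.ext_of_span_eq_top (g := fun ⦃_⦄ => g) (fun _ => hg) fun r => ?_
    exact (Submodule.Quotient.mk_eq_zero _).2 (Ideal.subset_span ⟨r, rfl⟩)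
  rw [Ideal.eq_top_iff_one, ← e.det_self]
  exact (Submodule.Quotient.mk_eq_zero _).1 (DFunLike.congr_fun h ⇑e)

variable [IsDomain R] [IsPrincipalIdealRing R]

/-- The maximal minors of a generating family of a submodule `W` of a free module `N` determine
the structure of `N ⧸ W`. -/
theorem exists_minors_generator {N : Type u} [AddCommGroup N] [Module R N] {κ ι : Type}
    [Fintype κ] [DecidableEq κ] (b : Basis κ R N) (g : ι → N) :
    ∃ f : R, Ideal.span {a | ∃ r : κ → ι, a = b.det fun i => g (r i)} = Ideal.span {f} ∧
      ((∃ c : κ → R, (∀ i, c i ≠ 0) ∧ f = ∏ i, c i ∧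
        Nonempty ((N ⧸ Submodule.span R (Set.range g)) ≃ₗ[R] ∀ i, R ⧸ Ideal.span {c i})) ∨
      (f = 0 ∧ ∃ x : N ⧸ Submodule.span R (Set.range g), ∀ a : R, a • x = 0 → a = 0)) := by
  set W := Submodule.span R (Set.range g) with hW
  have : Module.Finite R N := Module.Finite.of_basis b
  have : Module.Free R N := Module.Free.of_basis b
  by_cases hr : finrank R W = finrank R N
  · refine ⟨∏ i, Submodule.smithNormalFormCoeffs b hr i, ?_,
      Or.inl ⟨_, Submodule.smithNormalFormCoeffs_ne_zero b hr, rfl,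
        ⟨Submodule.quotientEquivPiSpan W b hr⟩⟩⟩
    let e := Submodule.smithNormalFormBotBasis b hr
    let g' : ι → W := fun i => ⟨g i, Submodule.subset_span ⟨i, rfl⟩⟩
    have hg' : Submodule.span R (Set.range g') = ⊤ := by
      refine Submodule.map_injective_of_injective W.subtype_injective ?_
      rw [Submodule.map_span, Submodule.map_top, Submodule.range_subtype, ← Set.range_comp]
      rfl
    -- The restriction of `b.det` to `W` is a top form, hence a multiple of `e.det`.
    have hdet : ∀ r : κ → ι, b.det (fun i => g (r i)) =
        b.det (fun i => (e i : N)) * e.det fun i => g' (r i) := fun r => by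
      have h := (b.det.compLinearMap W.subtype).eq_smul_basis_det e
      exact congrFun (congrArg DFunLike.coe h) fun i => g' (r i)
    have he : b.det (fun i => (e i : N)) = (∏ i, Submodule.smithNormalFormCoeffs b hr i) *
        b.det (Submodule.smithNormalFormTopBasis b hr) := by
      rw [← smul_eq_mul, ← AlternatingMap.map_smul_univ]
      exact congrArg b.det (funext fun i => Submodule.smithNormalFormBotBasis_def b hr i)
    have hset : {a | ∃ r : κ → ι, a = b.det fun i => g (r i)} =
        (fun a => b.det (fun i => (e i : N)) * a) ''
          {a | ∃ r : κ → ι, a = e.det fun i => g' (r i)} := by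
      ext a
      constructor
      · rintro ⟨r, rfl⟩
        exact ⟨_, ⟨r, rfl⟩, (hdet r).symm⟩
      · rintro ⟨_, ⟨r, rfl⟩, rfl⟩
        exact ⟨r, (hdet r).symm⟩
    have hspan : Ideal.span ((fun a => b.det (fun i => (e i : N)) * a) ''
        {a | ∃ r : κ → ι, a = e.det fun i => g' (r i)}) =
        Ideal.span {b.det fun i => (e i : N)} := by
      have h1 : (fun a => b.det (fun i => (e i : N)) * a) ''
          {a | ∃ r : κ → ι, a = e.det fun i => g' (r i)} =
          ({b.det fun i => (e i : N)} : Set R) * {a | ∃ r : κ → ι, a = e.det fun i => g' (r i)} := by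
        rw [Set.singleton_mul]
      rw [h1, ← Ideal.span_mul_span', span_basis_det_eq_top e g' hg', Ideal.mul_top]
    rw [hset, hspan, he, Ideal.span_singleton_eq_span_singleton]
    exact associated_mul_unit_left _ _ (b.isUnit_det _)
  -- If `W` has smaller rank, all tuples of full length in it are dependent, and the quotient has
  -- positive rank, so it cannot be torsion.
  · refine ⟨0, ?_, Or.inr ⟨rfl, ?_⟩⟩
    · refine le_antisymm (Ideal.span_le.2 ?_) (by simp)
      rintro _ ⟨r, rfl⟩
      rw [SetLike.mem_coe, Ideal.mem_span_singleton, zero_dvd_iff]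
      refine AlternatingMap.map_linearDependent _ _ fun hli => hr ?_
      have hli' : LinearIndependent R fun i => (⟨g (r i), Submodule.subset_span ⟨r i, rfl⟩⟩ : W) :=
        LinearIndependent.of_comp W.subtype hli
      refine le_antisymm (Submodule.finrank_le W) ?_
      rw [finrank_eq_card_basis b]
      exact hli'.fintype_card_le_finrank
    · by_contra hx
      push Not at hx
      have h0 : finrank R (N ⧸ W) = 0 := finrank_eq_zero_iff.2 fun x => by
        obtain ⟨a, ha, ha'⟩ := hx x
        exact ⟨a, ha', ha⟩
      have := Submodule.finrank_quotient_add_finrank W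
      rw [h0, zero_add] at this
      exact hr this

/-- The submaximal minors of a matrix whose rows are killed by a nonzero functional `d`
determine the structure of the kernel of the induced functional on the cokernel. -/
theorem exists_submaximal_minors_generator {n : ℕ} {ι : Type} (g : ι → Fin n → R)
    (B : Submodule R (Fin n → R)) (hB : B = Submodule.span R (Set.range g))
    (d : ((Fin n → R) ⧸ B) →ₗ[R] R) (hd : d ≠ 0) :
    ∃ f : R, Ideal.span {a | ∃ (r : Fin (n - 1) → ι) (c : Fin (n - 1) → Fin n),
        a = ((Matrix.of g).submatrix r c).det} = Ideal.span {f} ∧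
      ((∃ c : Fin (n - 1) → R, (∀ i, c i ≠ 0) ∧ f = ∏ i, c i ∧
        Nonempty (LinearMap.ker d ≃ₗ[R] ∀ i, R ⧸ Ideal.span {c i})) ∨
      (f = 0 ∧ ∃ x : LinearMap.ker d, ∀ a : R, a • x = 0 → a = 0)) := by
  -- For `n = 0` the truncated `n - 1` would be wrong, but the source of `d` is then zero, contrary
  -- to `hd`.
  obtain _ | m := n
  · exact absurd (LinearMap.ext fun x => by
      obtain ⟨y, rfl⟩ := Submodule.mkQ_surjective _ x
      rw [Subsingleton.elim y 0, map_zero, map_zero, map_zero]) hd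
  rw [Nat.add_sub_cancel]
  let D : (Fin (m + 1) → R) →ₗ[R] R := d.comp B.mkQ
  have hD : D ≠ 0 := fun h => hd (LinearMap.ext fun x => by
    obtain ⟨y, rfl⟩ := Submodule.mkQ_surjective _ x
    exact LinearMap.congr_fun h y)
  set N := LinearMap.ker D with hN
  -- The image of `D` is principal and nonzero, so a preimage `v` of its generator spans a free
  -- complement of `N`.
  obtain ⟨z, hz⟩ := (IsPrincipalIdealRing.principal (LinearMap.range D)).principal
  have hz0 : z ≠ 0 := fun h => hD (LinearMap.range_eq_bot.1 (by rw [hz, h]; simp))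
  obtain ⟨v, hv⟩ : z ∈ LinearMap.range D := by
    rw [hz]; exact Submodule.mem_span_singleton_self z
  have hsp : ∀ y, ∃ c : R, y + c • v ∈ N := fun y => by
    have : D y ∈ LinearMap.range D := LinearMap.mem_range_self D y
    rw [hz] at this
    obtain ⟨c, hc⟩ := Submodule.mem_span_singleton.1 this
    refine ⟨-c, ?_⟩
    rw [hN, LinearMap.mem_ker, map_add, map_smul, hv, neg_smul, hc, add_neg_cancel]
  have hli : ∀ (c : R), ∀ y ∈ N, c • v + y = 0 → c = 0 := fun c y hy h => by
    have := congrArg D h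
    rw [map_add, map_smul, hv, LinearMap.mem_ker.1 hy, add_zero, map_zero, smul_eq_mul] at this
    exact (mul_eq_zero.1 this).resolve_right hz0
  obtain ⟨k, ⟨bN⟩⟩ := Submodule.nonempty_basis_of_pid (Pi.basisFun R (Fin (m + 1))) N
  obtain rfl : k = m := by
    have h := finrank_eq_card_basis (Basis.mkFinCons v bN hli hsp)
    simpa using h.symm
  let e := Basis.mkFinCons v bN hli hsp
  have hgB : ∀ i, g i ∈ B := fun i => by rw [hB]; exact Submodule.subset_span ⟨i, rfl⟩
  have hBN : B ≤ N := fun y hy => by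
    change d (B.mkQ y) = 0
    rw [Submodule.mkQ_apply, (Submodule.Quotient.mk_eq_zero _).2 hy, map_zero]
  let g' : ι → N := fun i => ⟨g i, hBN (hgB i)⟩
  obtain ⟨f, hf, hcase⟩ := exists_minors_generator bN g'
  -- the minors of the basis of `N`
  let ω : (Fin k → Fin (k + 1)) → N [⋀^Fin k]→ₗ[R] R := fun c =>
    Matrix.detRowAlternating.compLinearMap ((LinearMap.funLeft R R c).comp N.subtype)
  have hω : ∀ (r : Fin k → ι) (c : Fin k → Fin (k + 1)),
      ((Matrix.of g).submatrix r c).det = ω c bN * bN.det fun i => g' (r i) := fun r c =>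
    congrFun (congrArg DFunLike.coe ((ω c).eq_smul_basis_det bN)) fun i => g' (r i)
  have htop : Ideal.span (Set.range fun c => ω c bN) = ⊤ := by
    have hu : IsUnit ((Pi.basisFun R (Fin (k + 1))).det e) := Basis.isUnit_det _ _
    refine Ideal.eq_top_of_isUnit_mem _ ?_ hu
    -- The determinant of the basis `(v, bN)` is a unit; expanding it along the row `v` writes it as
    -- a combination of the column factors.
    rw [Pi.basisFun_det_apply, Matrix.det_succ_row_zero]
    refine Ideal.sum_mem _ fun j _ => Ideal.mul_mem_left _ _ (Ideal.subset_span ⟨j.succAbove, ?_⟩)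
    change Matrix.det _ = Matrix.det _
    congr 1
    ext i l
    simp [e, LinearMap.funLeft]
  have hspan : Ideal.span {a | ∃ (r : Fin k → ι) (c : Fin k → Fin (k + 1)),
      a = ((Matrix.of g).submatrix r c).det} = Ideal.span {f} := by
    have hset : {a | ∃ (r : Fin k → ι) (c : Fin k → Fin (k + 1)),
        a = ((Matrix.of g).submatrix r c).det} =
        (Set.range fun c => ω c bN) * {a | ∃ r : Fin k → ι, a = bN.det fun i => g' (r i)} := by
      ext a
      rw [Set.mem_mul]
      constructor
      · rintro ⟨r, c, rfl⟩
        exact ⟨_, ⟨c, rfl⟩, _, ⟨r, rfl⟩, (hω r c).symm⟩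
      · rintro ⟨_, ⟨c, rfl⟩, _, ⟨r, rfl⟩, rfl⟩
        exact ⟨r, c, (hω r c).symm⟩
    rw [hset, ← Ideal.span_mul_span', htop, Ideal.top_mul, hf]
  -- the kernel of `d` as a quotient of `N`
  let q : N →ₗ[R] LinearMap.ker d := B.mkQ.restrict fun y hy => hy
  have hq : Function.Surjective q := by
    rintro ⟨y, hy⟩
    obtain ⟨y, rfl⟩ := Submodule.mkQ_surjective _ y
    exact ⟨⟨y, hy⟩, rfl⟩
  have hker : LinearMap.ker q = Submodule.span R (Set.range g') := by
    refine Submodule.map_injective_of_injective N.subtype_injective ?_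
    rw [Submodule.map_span, ← Set.range_comp]
    change _ = Submodule.span R (Set.range g)
    rw [← hB]
    ext y
    constructor
    · rintro ⟨y, hy, rfl⟩
      exact (Submodule.Quotient.mk_eq_zero B).1 (congrArg Subtype.val hy)
    · intro hy
      exact ⟨⟨y, hBN hy⟩, Subtype.ext ((Submodule.Quotient.mk_eq_zero B).2 hy), rfl⟩
  let E : LinearMap.ker d ≃ₗ[R] N ⧸ Submodule.span R (Set.range g') :=
    ((Submodule.quotEquivOfEq _ _ hker.symm).trans (q.quotKerEquivOfSurjective hq)).symm
  refine ⟨f, hspan, hcase.imp ?_ ?_⟩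
  · rintro ⟨c, hc, hfc, ⟨E'⟩⟩
    exact ⟨c, hc, hfc, ⟨E.trans E'⟩⟩
  · rintro ⟨h0, y, hy⟩
    refine ⟨h0, E.symm y, fun a ha => hy a ?_⟩
    rwa [← map_smul, LinearEquiv.map_eq_zero_iff] at ha

end Minors
end

noncomputable section

/-! ## Laurent polynomials over a field -/

namespace LaurentPolynomial

open Module Polynomial

variable {K : Type u} [Field K]

instance isPrincipalIdealRing_laurent : IsPrincipalIdealRing K[T;T⁻¹] where
  principal I := by
    obtain ⟨p, hp⟩ := (IsPrincipalIdealRing.principal (I.comap (algebraMap K[X] K[T;T⁻¹]))).principal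
    refine ⟨algebraMap K[X] K[T;T⁻¹] p, ?_⟩
    rw [← IsLocalization.map_under (Submonoid.powers (X : K[X])) K[T;T⁻¹] I, Ideal.under, hp]
    change Ideal.map _ (Ideal.span {p}) = Ideal.span _
    rw [Ideal.map_span, Set.image_singleton]

/-- `f` is a monomial times a polynomial of degree `d` with non-zero constant coefficient. -/
def HasSpan (f : K[T;T⁻¹]) (d : ℕ) : Prop :=
  ∃ (k : ℤ) (p : K[X]), f = T k * toLaurent p ∧ p.coeff 0 ≠ 0 ∧ p.natDegree = d

/-- A power of `T` makes `f` a polynomial, from which the root at `0` is then stripped off. -/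
theorem exists_hasSpan {f : K[T;T⁻¹]} (hf : f ≠ 0) : ∃ d, HasSpan f d := by
  obtain ⟨n, q, hq⟩ := f.exists_T_pow
  have hfq : f = toLaurent q * T (-n) := by
    rw [hq, mul_assoc, ← T_add, add_neg_cancel, T_zero, mul_one]
  have hq0 : q ≠ 0 := by
    rintro rfl
    exact hf (by rw [hfq, map_zero, zero_mul])
  obtain ⟨p, hp, hp0⟩ := Polynomial.exists_eq_pow_rootMultiplicity_mul_and_not_dvd q hq0 0
  rw [map_zero, sub_zero] at hp hp0
  refine ⟨_, -n + q.rootMultiplicity 0, p, ?_, fun h => hp0 (X_dvd_iff.2 h), rfl⟩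
  have hp' := congrArg toLaurent hp
  rw [map_mul, toLaurent_X_pow] at hp'
  rw [hfq, hp', T_add]
  ring

theorem HasSpan.mul {f g : K[T;T⁻¹]} {d e : ℕ} (hf : HasSpan f d) (hg : HasSpan g e) :
    HasSpan (f * g) (d + e) := by
  obtain ⟨k, p, rfl, hp, rfl⟩ := hf
  obtain ⟨l, q, rfl, hq, rfl⟩ := hg
  refine ⟨k + l, p * q, by rw [map_mul, T_add]; ring, ?_, ?_⟩
  · rw [mul_coeff_zero]; exact mul_ne_zero hp hq
  · refine natDegree_mul ?_ ?_
    · rintro rfl; simp at hp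
    · rintro rfl; simp at hq

theorem HasSpan.prod {ι : Type*} (s : Finset ι) {f : ι → K[T;T⁻¹]} {d : ι → ℕ}
    (h : ∀ i, HasSpan (f i) (d i)) : HasSpan (∏ i ∈ s, f i) (∑ i ∈ s, d i) := by
  classical
  induction s using Finset.induction_on with
  | empty => exact ⟨0, 1, by simp, by simp, by simp⟩
  | insert i s hi ih => rw [Finset.prod_insert hi, Finset.sum_insert hi]; exact (h i).mul ih

/-- As `p(0) ≠ 0`, the variable is already invertible modulo `p`, so inverting it does not change
`K[X]/(p)`, whose dimension is the degree of `p`. -/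
theorem finite_quotient_of_hasSpan {f : K[T;T⁻¹]} {d : ℕ} (hf : HasSpan f d) :
    Module.Finite K (K[T;T⁻¹] ⧸ Ideal.span {f}) ∧
      finrank K (K[T;T⁻¹] ⧸ Ideal.span {f}) = d := by
  obtain ⟨k, p, rfl, hp, rfl⟩ := hf
  have hspan : Ideal.span {T k * toLaurent p} = Ideal.span {toLaurent p} :=
    Ideal.span_singleton_eq_span_singleton.2 (associated_unit_mul_left _ _ (isUnit_T k))
  rw [hspan]
  have hp0 : p ≠ 0 := by rintro rfl; simp at hp
  let F : K[X] →ₐ[K] K[T;T⁻¹] ⧸ Ideal.span {toLaurent p} :=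
    (Ideal.Quotient.mkₐ K _).comp toLaurentAlg
  have hFapp : ∀ q, F q = Ideal.Quotient.mk _ (toLaurent q) := fun q => rfl
  have hcop : ∀ n : ℕ, IsCoprime p (X ^ n) := fun n => by
    refine IsCoprime.pow_right ?_
    refine ((prime_X (R := K)).irreducible.coprime_iff_not_dvd.2 fun h => hp ?_).symm
    exact X_dvd_iff.1 h
  have hker : RingHom.ker F = Ideal.span {p} := by
    ext q
    rw [RingHom.mem_ker, hFapp, Ideal.Quotient.eq_zero_iff_mem, Ideal.mem_span_singleton,
      Ideal.mem_span_singleton]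
    constructor
    · rintro ⟨g, hg⟩
      obtain ⟨n, g', hg'⟩ := g.exists_T_pow
      have : q * X ^ n = p * g' := by
        refine toLaurent_injective ?_
        rw [map_mul, map_mul, toLaurent_X_pow, hg, hg']
        ring
      exact (hcop n).dvd_of_dvd_mul_right ⟨g', this⟩
    · rintro ⟨g, rfl⟩
      exact ⟨toLaurent g, map_mul _ _ _⟩
  have hsurj : Function.Surjective F := by
    intro y
    obtain ⟨g, rfl⟩ := Ideal.Quotient.mk_surjective y
    obtain ⟨n, g', hg'⟩ := g.exists_T_pow
    obtain ⟨a, b, hab⟩ := hcop n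
    -- From `a p + b Xⁿ = 1`, the factor `b` inverts `Xⁿ` modulo `p`, and `g` is `g'` divided by
    -- `Tⁿ`.
    refine ⟨b * g', ?_⟩
    rw [hFapp, Ideal.Quotient.mk_eq_mk_iff_sub_mem, Ideal.mem_span_singleton]
    have h1 : toLaurent b * T n = 1 - toLaurent a * toLaurent p := by
      rw [← toLaurent_X_pow, ← map_mul, ← map_mul, ← map_one toLaurent, ← map_sub, ← hab]
      congr 1; ring
    refine ⟨-(toLaurent a * g), ?_⟩
    rw [map_mul, hg', show toLaurent b * (g * T n) = toLaurent b * T n * g by ring, h1]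
    ring
  let E : (K[X] ⧸ Ideal.span {p}) ≃ₗ[K] K[T;T⁻¹] ⧸ Ideal.span {toLaurent p} :=
    ((Ideal.quotientEquivAlgOfEq K hker.symm).trans
      (Ideal.quotientKerAlgEquivOfSurjective hsurj)).toLinearEquiv
  have hfr : finrank K (K[X] ⧸ Ideal.span {p}) = p.natDegree := finrank_quotient_span_eq_natDegree
  have hfin : Module.Finite K (K[X] ⧸ Ideal.span {p}) :=
    (AdjoinRoot.powerBasis hp0).finite
  exact ⟨Module.Finite.equiv E, by rw [← E.finrank_eq, hfr]⟩

theorem not_finite_laurent : ¬ Module.Finite K K[T;T⁻¹] := fun _ =>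
  Polynomial.not_finite (R := K) <|
    Module.Finite.of_injective (toLaurentAlg (R := K)).toLinearMap toLaurent_injective

/-- The maximal difference of two exponents of a Laurent polynomial is its span. -/
theorem sup_support_eq_of_hasSpan {f : K[T;T⁻¹]} {d : ℕ} (hf : HasSpan f d) :
    ((f.coeff.support ×ˢ f.coeff.support).sup fun p => (p.1 - p.2).natAbs) = d := by
  obtain ⟨k, p, rfl, hp, rfl⟩ := hf
  have hcoeff : ∀ n : ℤ, (T k * toLaurent p).coeff n = (toLaurent p).coeff (n - k) := fun n => by
    refine (AddMonoidAlgebra.coeff_single_mul_eq_mul_coeff (n - k) fun m _ => ?_).trans (one_mul _)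
    omega
  have hsupp : ∀ n : ℤ, n ∈ (T k * toLaurent p).coeff.support ↔
      ∃ m ∈ p.support, n = k + (m : ℕ) := fun n => by
    rw [Finsupp.mem_support_iff, hcoeff, ← Finsupp.mem_support_iff, support_coeff_toLaurent]
    simp only [Finset.mem_map, Nat.castEmbedding_apply]
    exact exists_congr fun m => and_congr_right fun _ => by constructor <;> intro h <;> omega
  have hp0 : p ≠ 0 := by rintro rfl; simp at hp
  refine le_antisymm (Finset.sup_le ?_) ?_
  · rintro ⟨a, b⟩ hab
    obtain ⟨ha, hb⟩ := Finset.mem_product.1 hab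
    obtain ⟨m, hm, h1⟩ := (hsupp a).1 ha
    obtain ⟨l, hl, h2⟩ := (hsupp b).1 hb
    have := le_natDegree_of_mem_supp m hm
    have := le_natDegree_of_mem_supp l hl
    change (a - b).natAbs ≤ _
    omega
  · have h := Finset.le_sup (f := fun p : ℤ × ℤ => (p.1 - p.2).natAbs)
      (Finset.mk_mem_product
        ((hsupp (k + (p.natDegree : ℕ))).2 ⟨_, natDegree_mem_support_of_nonzero hp0, rfl⟩)
        ((hsupp (k + (0 : ℕ))).2 ⟨0, mem_support_iff.2 hp, rfl⟩))
    simpa using h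

end LaurentPolynomial
end

noncomputable section

/-! ## Greatest common divisors in factorial rings -/

section Gcd

/-- Common divisors depend only on the ideal generated by `S`, which has finitely many generators.
-/
theorem exists_isGcdOfSet {B : Type u} [CommRing B] [IsDomain B] [UniqueFactorizationMonoid B]
    [IsNoetherianRing B] (S : Set B) : ∃ d, IsGcdOfSet S d := by
  obtain ⟨inst⟩ : Nonempty (NormalizedGCDMonoid B) := inferInstance
  obtain ⟨t, ht⟩ := IsNoetherian.noetherian (Ideal.span S)
  have key : ∀ (e : B) (A : Set B), (∀ a ∈ A, e ∣ a) ↔ Ideal.span A ≤ Ideal.span {e} :=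
    fun e A => by
      rw [Ideal.span_le]
      exact forall₂_congr fun a _ => Ideal.mem_span_singleton.symm
  refine ⟨t.gcd id, fun e => ?_⟩
  rw [Finset.dvd_gcd_iff, key e S, ← ht]
  exact key e t

variable {B : Type u} {L : Type v} [CommRing B] [IsDomain B] [UniqueFactorizationMonoid B]
  [CommRing L] (j : B →+* L)

/-- Discard the prime factors of `b` that divide some element inverted by `j`: they become units
themselves, and the remaining ones are prime to every denominator. -/
theorem exists_associated_isRelPrime {b : B} (hb : b ≠ 0) :
    ∃ f : B, Associated (j b) (j f) ∧ ∀ m, IsUnit (j m) → IsRelPrime f m := by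
  induction b using UniqueFactorizationMonoid.induction_on_prime with
  | h₁ => exact absurd rfl hb
  | h₂ x hx =>
    refine ⟨1, ?_, fun m _ => isRelPrime_one_left⟩
    rw [map_one]
    exact associated_one_iff_isUnit.2 (hx.map j)
  | h₃ a p ha hp ih =>
    obtain ⟨f, hf, hm⟩ := ih ha
    by_cases h : ∃ m, IsUnit (j m) ∧ p ∣ m
    · obtain ⟨m, hu, hpm⟩ := h
      refine ⟨f, ?_, hm⟩
      rw [map_mul]
      exact (associated_unit_mul_left _ _ (isUnit_of_dvd_unit (map_dvd j hpm) hu)).trans hf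
    · push Not at h
      refine ⟨p * f, ?_, fun m hu => IsRelPrime.mul_left
        (hp.irreducible.isRelPrime_iff_not_dvd.2 (h m hu)) (hm m hu)⟩
      rw [map_mul, map_mul]
      exact hf.mul_left _

/-- A greatest common divisor in a factorial ring generates, in a localization which is a principal
ideal domain, the ideal generated by the set. -/
theorem span_image_eq_of_isGcdOfSet [IsDomain L] [IsPrincipalIdealRing L] (hj : Function.Injective j)
    (hloc : ∀ f, ∃ b m, IsUnit (j m) ∧ f * j m = j b) {S : Set B} {d : B}
    (hd : IsGcdOfSet S d) : Ideal.span (j '' S) = Ideal.span {j d} := by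
  obtain ⟨f, hf⟩ := (IsPrincipalIdealRing.principal (Ideal.span (j '' S))).principal
  change _ = Ideal.span {f} at hf
  have hdS : ∀ a ∈ S, j d ∣ j a := fun a ha => map_dvd j ((hd d).1 dvd_rfl a ha)
  have hdf : j d ∣ f := by
    rw [← Ideal.mem_span_singleton]
    have : f ∈ Ideal.span (j '' S) := by rw [hf]; exact Ideal.mem_span_singleton_self f
    refine Ideal.span_le.2 ?_ this
    rintro _ ⟨a, ha, rfl⟩
    exact Ideal.mem_span_singleton.2 (hdS a ha)
  have hfS : ∀ a ∈ S, f ∣ j a := fun a ha => by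
    rw [← Ideal.mem_span_singleton, ← hf]
    exact Ideal.subset_span ⟨a, ha, rfl⟩
  rw [hf, Ideal.span_singleton_eq_span_singleton]
  refine associated_of_dvd_dvd ?_ hdf
  obtain ⟨b, m, hm, hb⟩ := hloc f
  have hfb : Associated f (j b) := by rw [← hb]; exact (associated_mul_unit_left _ _ hm).symm
  by_cases hb0 : b = 0
  -- Here the ideal is zero, so `S` contains only zero and `0` divides `d`.
  · subst hb0
    rw [map_zero, associated_zero_iff_eq_zero] at hfb
    subst hfb
    have : (0 : B) ∣ d := (hd 0).2 fun a ha => by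
      have := zero_dvd_iff.1 (hfS a ha)
      rw [← map_zero j] at this
      rw [hj this]
    rw [zero_dvd_iff.1 this, map_zero]
  -- Taking `g` prime to all denominators, an equation `a m' = g c'` with `m'` inverted gives `g ∣
  -- a` in `B` itself. Hence `g` divides the gcd.
  · obtain ⟨g, hg, hrel⟩ := exists_associated_isRelPrime j hb0
    have hfg : Associated f (j g) := hfb.trans hg
    refine hfg.dvd.trans (map_dvd j ((hd g).2 fun a ha => ?_))
    obtain ⟨c, hc⟩ := hfg.symm.dvd.trans (hfS a ha)
    obtain ⟨c', m', hm', hc'⟩ := hloc c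
    have : a * m' = g * c' := hj (by rw [map_mul, map_mul, hc, mul_assoc, hc'])
    exact (hrel m' hm').dvd_of_dvd_mul_right ⟨c', this⟩

end Gcd

/-! ### Factoriality and noetherianity of group algebras -/

section GroupAlgebra

open Module

instance uniqueFactorizationMonoid_laurent {R : Type u} [CommRing R] [IsDomain R]
    [UniqueFactorizationMonoid R] : UniqueFactorizationMonoid (LaurentPolynomial R) :=
  UniqueFactorizationMonoid.of_isLocalization (Submonoid.powers (Polynomial.X : Polynomial R)) _

theorem uniqueFactorizationMonoid_addMonoidAlgebra_pi (R : Type u) [CommRing R] [IsDomain R]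
    [UniqueFactorizationMonoid R] (n : ℕ) :
    UniqueFactorizationMonoid (AddMonoidAlgebra R (Fin n → ℤ)) := by
  induction n with
  | zero =>
    exact (AddMonoidAlgebra.uniqueRingEquiv (R := R) (Fin 0 → ℤ)).symm.toMulEquiv.uniqueFactorizationMonoid
      inferInstance
  | succ n ih =>
    -- Splitting off a factor `ℤ` turns the group algebra into Laurent polynomials over the previous
    -- one.
    let e : (ℤ × (Fin n → ℤ)) ≃ₗ[ℤ] (Fin (n + 1) → ℤ) :=
      LinearEquiv.ofFinrankEq _ _ (by simp [add_comm])
    have h : UniqueFactorizationMonoid (LaurentPolynomial (AddMonoidAlgebra R (Fin n → ℤ))) :=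
      inferInstance
    exact (AddMonoidAlgebra.curryRingEquiv.symm.trans
      (AddMonoidAlgebra.domCongr R R e.toAddEquiv).toRingEquiv).toMulEquiv.uniqueFactorizationMonoid h

theorem uniqueFactorizationMonoid_monoidAlgebra (G : Type u) [CommGroup G] [IsMulTorsionFree G]
    [Group.FG G] : UniqueFactorizationMonoid (MonoidAlgebra ℂ G) := by
  have : Module.Finite ℤ (Additive G) := Module.Finite.iff_addGroup_fg.2 inferInstance
  have : Module.IsTorsionFree ℤ (Additive G) := inferInstance
  let e := Module.finBasis ℤ (Additive G)
  exact ((AddMonoidAlgebra.domCongr ℂ ℂ e.equivFun.toAddEquiv.symm).toRingEquiv.trans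
    (MonoidAlgebra.toAdditive ℂ G).symm).toMulEquiv.uniqueFactorizationMonoid
    (uniqueFactorizationMonoid_addMonoidAlgebra_pi ℂ _)

theorem isNoetherianRing_monoidAlgebra (G : Type u) [CommGroup G] [Group.FG G] :
    IsNoetherianRing (MonoidAlgebra ℂ G) :=
  have : Monoid.FG G := Group.fg_iff_monoid_fg.1 inferInstance
  Algebra.FiniteType.isNoetherianRing ℂ _

end GroupAlgebra
end

noncomputable section

/-! ## The embedding of the group algebra into the Laurent polynomials -/

section Embedding

open LaurentPolynomial

variable {Γ : Type u} [Group Γ] (s s' : TorsionSplitting (Abelianization Γ))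
  (σ : CommGroup.torsion (Abelianization Γ) →* ℂˣ) (ψ : Γ →* Multiplicative ℤ)
  (τ : Abelianization Γ) (hτ : Abelianization.lift ψ τ = Multiplicative.ofAdd 1)

theorem kerPart_coe (τ : FreeQuot (Abelianization Γ))
    (hτ : inducedClass ψ τ = Multiplicative.ofAdd 1) (g : FreeQuot (Abelianization Γ)) :
    (kerPart ψ τ hτ g : FreeQuot (Abelianization Γ)) =
      g * (τ ^ (inducedClass ψ g).toAdd)⁻¹ := rfl

/-- Uniqueness of coordinates in the decomposition `G = U × (τ)`. -/
theorem kerPart_eq_iff (τ : FreeQuot (Abelianization Γ))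
    (hτ : inducedClass ψ τ = Multiplicative.ofAdd 1) (g : FreeQuot (Abelianization Γ))
    (v : (inducedClass ψ).ker) (n : ℤ) :
    ((inducedClass ψ g).toAdd = n ∧ kerPart ψ τ hτ g = v) ↔ g = v * τ ^ n := by
  constructor
  · rintro ⟨rfl, rfl⟩
    rw [kerPart_coe, inv_mul_cancel_right]
  · intro h
    have hg : (inducedClass ψ g).toAdd = n := by
      rw [h, map_mul, map_zpow, hτ, MonoidHom.mem_ker.1 v.2, one_mul, ← ofAdd_zsmul, smul_eq_mul,
        mul_one, toAdd_ofAdd]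
    refine ⟨hg, Subtype.ext ?_⟩
    rw [kerPart_coe, hg, h, mul_inv_cancel_right]

theorem TorsionSplitting.torsionPart_coe (t : CommGroup.torsion (Abelianization Γ)) :
    s'.torsionPart t = t := by
  refine Subtype.ext ?_
  change (t : Abelianization Γ) *
    (s'.lift ((t : Abelianization Γ) : FreeQuot (Abelianization Γ)))⁻¹ = t
  rw [(QuotientGroup.eq_one_iff _).2 t.2, map_one, inv_one, mul_one]

/-- The character by which the twists of two splittings differ. -/
def splittingCharacter : FreeQuot (Abelianization Γ) →* ℂˣ :=
  σ.comp (s'.torsionPart.comp s.lift)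

theorem torsionPart_mul_splittingCharacter (h : Abelianization Γ) :
    σ (s'.torsionPart h) = σ (s.torsionPart h) * splittingCharacter s s' σ h := by
  have h2 : h = (s.torsionPart h : Abelianization Γ) * s.lift h := by
    change h = h * (s.lift h)⁻¹ * s.lift h
    rw [inv_mul_cancel_right]
  conv_lhs => rw [h2]
  rw [map_mul, s'.torsionPart_coe, map_mul]
  rfl

/-- The ring homomorphism `ℂ[G] → K[t^{±1}]` through which the reduction of `φ` factors. -/
def phiTwist : MonoidAlgebra ℂ (FreeQuot (Abelianization Γ)) →+*
    LaurentPolynomial (CoeffField ψ) :=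
  MonoidAlgebra.liftNCRingHom
    ((C : CoeffField ψ →+* _).comp ((algebraMap (MonoidAlgebra ℂ (inducedClass ψ).ker) _).comp
      MonoidAlgebra.singleOneRingHom))
    ((phiHom s' σ ψ τ hτ).comp s.lift) fun _ _ => Commute.all _ _

theorem splittingCharacter_apply (g : FreeQuot (Abelianization Γ)) :
    splittingCharacter s s' σ g = σ (s'.torsionPart (s.lift g)) := rfl

theorem phiHom_apply {h : Abelianization Γ} {g : FreeQuot (Abelianization Γ)} (hg : h = g) :
    phiHom s' σ ψ τ hτ h = C (algebraMap _ (CoeffField ψ)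
      (MonoidAlgebra.single (kerPart ψ τ ((inducedClass_mk ψ τ).trans hτ) g)
        (σ (s'.torsionPart h) : ℂ))) * T (inducedClass ψ g).toAdd := by
  subst hg; rfl

theorem phiTwist_single (g : FreeQuot (Abelianization Γ)) (c : ℂ) :
    phiTwist s s' σ ψ τ hτ (MonoidAlgebra.single g c) =
      C (algebraMap _ (CoeffField ψ)
        (MonoidAlgebra.single (kerPart ψ τ ((inducedClass_mk ψ τ).trans hτ) g)
          (c * splittingCharacter s s' σ g))) * T (inducedClass ψ g).toAdd := by
  have h : MonoidAlgebra.single (kerPart ψ τ ((inducedClass_mk ψ τ).trans hτ) g)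
      (c * splittingCharacter s s' σ g : ℂ) = MonoidAlgebra.single 1 c *
      MonoidAlgebra.single (kerPart ψ τ ((inducedClass_mk ψ τ).trans hτ) g)
        (splittingCharacter s s' σ g : ℂ) := by
    rw [MonoidAlgebra.single_mul_single, one_mul]
  have e : phiTwist s s' σ ψ τ hτ (MonoidAlgebra.single g c) =
      C (algebraMap (MonoidAlgebra ℂ (inducedClass ψ).ker) (CoeffField ψ)
        (MonoidAlgebra.single 1 c)) * phiHom s' σ ψ τ hτ (s.lift g) := by
    rw [phiTwist, MonoidAlgebra.liftNCRingHom_single]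
    rfl
  rw [e, h, map_mul, map_mul, mul_assoc, phiHom_apply s' σ ψ τ hτ (s.mk_lift g),
    splittingCharacter_apply]

/-- The reduction of `φ` to `ℤ[H]`. -/
def phiAb : MonoidAlgebra ℤ (Abelianization Γ) →+* LaurentPolynomial (CoeffField ψ) :=
  MonoidAlgebra.liftNCRingHom (Int.castRingHom _) (phiHom s' σ ψ τ hτ) fun _ _ => Commute.all _ _

theorem phiAb_comp_mapDomain : (phiAb s' σ ψ τ hτ).comp
    (MonoidAlgebra.mapDomainRingHom ℤ Abelianization.of) = phi s' σ ψ τ hτ := by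
  refine MonoidAlgebra.ringHom_ext' (RingHom.ext_int _ _) (MonoidHom.ext fun γ => ?_)
  change phiAb s' σ ψ τ hτ (MonoidAlgebra.mapDomain _ (MonoidAlgebra.single γ 1)) =
    phi s' σ ψ τ hτ (MonoidAlgebra.single γ 1)
  rw [MonoidAlgebra.mapDomain_single, phiAb, phi, MonoidAlgebra.liftNCRingHom_single,
    MonoidAlgebra.liftNCRingHom_single]
  rfl

theorem twist_single (h : Abelianization Γ) :
    s.twist σ (MonoidAlgebra.single h 1) =
      MonoidAlgebra.single (h : FreeQuot (Abelianization Γ)) (σ (s.torsionPart h) : ℂ) := by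
  rw [TorsionSplitting.twist, MonoidAlgebra.liftNCRingHom_single, map_one, one_mul]
  rfl

theorem phiAb_single (h : Abelianization Γ) :
    phiAb s' σ ψ τ hτ (MonoidAlgebra.single h 1) = phiHom s' σ ψ τ hτ h := by
  rw [phiAb, MonoidAlgebra.liftNCRingHom_single, map_one, one_mul]

theorem phiTwist_twist_single (h : Abelianization Γ) :
    phiTwist s s' σ ψ τ hτ (s.twist σ (MonoidAlgebra.single h 1)) =
      phiAb s' σ ψ τ hτ (MonoidAlgebra.single h 1) := by
  rw [twist_single, phiAb_single, phiTwist_single, ← Units.val_mul,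
    ← torsionPart_mul_splittingCharacter, phiHom_apply s' σ ψ τ hτ rfl]

/-- The splitting character built into `phiTwist` compensates for the change from `s` to `s'`, so
`φ` factors through `σ̃` for any choice of the two splittings. -/
theorem phiTwist_comp_twist :
    (phiTwist s s' σ ψ τ hτ).comp (s.twist σ) = phiAb s' σ ψ τ hτ :=
  MonoidAlgebra.ringHom_ext
    (fun n => RingHom.congr_fun (RingHom.ext_int
      (((phiTwist s s' σ ψ τ hτ).comp (s.twist σ)).comp MonoidAlgebra.singleOneRingHom)
      ((phiAb s' σ ψ τ hτ).comp MonoidAlgebra.singleOneRingHom)) n)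
    (phiTwist_twist_single s s' σ ψ τ hτ)

/-- Distinct elements of `G` have distinct coordinates in `U × ℤ`, so nothing cancels: each
coefficient of `a` reappears once, up to a nonzero factor. Supports and injectivity are read off
from this. -/
theorem exists_coeff_phiTwist (a : MonoidAlgebra ℂ (FreeQuot (Abelianization Γ))) (n : ℤ) :
    ∃ y : MonoidAlgebra ℂ (inducedClass ψ).ker,
      (phiTwist s s' σ ψ τ hτ a).coeff n = algebraMap _ _ y ∧
      ∀ v : (inducedClass ψ).ker, y.coeff v =
        a.coeff (v * (τ : FreeQuot (Abelianization Γ)) ^ n) *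
          splittingCharacter s s' σ (v * (τ : FreeQuot (Abelianization Γ)) ^ n) := by
  classical
  induction a using MonoidAlgebra.induction_linear with
  | zero => exact ⟨0, by simp, by simp⟩
  | add a b ha hb =>
    obtain ⟨y, hy, hy'⟩ := ha
    obtain ⟨z, hz, hz'⟩ := hb
    refine ⟨y + z, ?_, fun v => ?_⟩
    · rw [map_add, AddMonoidAlgebra.coeff_add, Finsupp.add_apply, hy, hz, map_add]
    · rw [MonoidAlgebra.coeff_add, Finsupp.add_apply, hy', hz', MonoidAlgebra.coeff_add,
        Finsupp.add_apply, add_mul]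
  | single g c =>
    refine ⟨if (inducedClass ψ g).toAdd = n then MonoidAlgebra.single
      (kerPart ψ τ ((inducedClass_mk ψ τ).trans hτ) g) (c * splittingCharacter s s' σ g) else 0,
      ?_, fun v => ?_⟩
    · rw [phiTwist_single, ← single_eq_C_mul_T, AddMonoidAlgebra.coeff_single, Finsupp.single_apply]
      split_ifs
      · rfl
      · rw [map_zero]
    · have key := kerPart_eq_iff ψ τ ((inducedClass_mk ψ τ).trans hτ) g v n
      rw [MonoidAlgebra.coeff_single, Finsupp.single_apply]
      by_cases hg : g = v * (τ : FreeQuot (Abelianization Γ)) ^ n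
      · obtain ⟨h1, h2⟩ := key.2 hg
        rw [if_pos h1, if_pos hg, h2, ← hg, MonoidAlgebra.coeff_single, Finsupp.single_eq_same]
      · rw [if_neg hg, zero_mul]
        split_ifs with h1
        · rw [MonoidAlgebra.coeff_single, Finsupp.single_apply,
            if_neg fun h2 => hg (key.1 ⟨h1, h2⟩)]
        · rfl

theorem support_phiTwist (a : MonoidAlgebra ℂ (FreeQuot (Abelianization Γ))) (n : ℤ) :
    n ∈ (phiTwist s s' σ ψ τ hτ a).coeff.support ↔
      ∃ g ∈ a.coeff.support, (inducedClass ψ g).toAdd = n := by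
  obtain ⟨y, hy, hy'⟩ := exists_coeff_phiTwist s s' σ ψ τ hτ a n
  have hinj := IsFractionRing.injective (MonoidAlgebra ℂ (inducedClass ψ).ker) (CoeffField ψ)
  rw [Finsupp.mem_support_iff, hy, Ne, map_eq_zero_iff _ hinj]
  constructor
  · intro h
    obtain ⟨v, hv⟩ : ∃ v, y.coeff v ≠ 0 := by
      by_contra! h0
      exact h (MonoidAlgebra.ext (Finsupp.ext h0))
    rw [hy'] at hv
    exact ⟨_, Finsupp.mem_support_iff.2 (left_ne_zero_of_mul hv),
      ((kerPart_eq_iff ψ τ ((inducedClass_mk ψ τ).trans hτ) _ v n).2 rfl).1⟩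
  · rintro ⟨g, hg, hgn⟩ rfl
    have hgv := (kerPart_eq_iff ψ τ ((inducedClass_mk ψ τ).trans hτ) g _ n).1 ⟨hgn, rfl⟩
    have := hy' (kerPart ψ τ ((inducedClass_mk ψ τ).trans hτ) g)
    rw [← hgv] at this
    exact mul_ne_zero (Finsupp.mem_support_iff.1 hg) (Units.ne_zero _) this.symm

theorem phiTwist_injective : Function.Injective (phiTwist s s' σ ψ τ hτ) := by
  refine (injective_iff_map_eq_zero _).2 fun a ha => MonoidAlgebra.ext (Finsupp.ext fun g => ?_)
  by_contra hg
  have := (support_phiTwist s s' σ ψ τ hτ a _).2 ⟨g, Finsupp.mem_support_iff.2 hg, rfl⟩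
  rw [ha] at this
  simp at this

theorem spread_eq (a : MonoidAlgebra ℂ (FreeQuot (Abelianization Γ))) :
    spread (inducedClass ψ) a =
      ((phiTwist s s' σ ψ τ hτ a).coeff.support ×ˢ
        (phiTwist s s' σ ψ τ hτ a).coeff.support).sup fun p => (p.1 - p.2).natAbs := by
  refine le_antisymm (Finset.sup_le ?_) (Finset.sup_le ?_)
  · rintro ⟨g, g'⟩ h
    obtain ⟨hg, hg'⟩ := Finset.mem_product.1 h
    exact Finset.le_sup (f := fun p : ℤ × ℤ => (p.1 - p.2).natAbs) (Finset.mk_mem_product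
      ((support_phiTwist s s' σ ψ τ hτ a _).2 ⟨g, hg, rfl⟩)
      ((support_phiTwist s s' σ ψ τ hτ a _).2 ⟨g', hg', rfl⟩))
  · rintro ⟨m, n⟩ h
    obtain ⟨hm, hn⟩ := Finset.mem_product.1 h
    obtain ⟨g, hg, rfl⟩ := (support_phiTwist s s' σ ψ τ hτ a m).1 hm
    obtain ⟨g', hg', rfl⟩ := (support_phiTwist s s' σ ψ τ hτ a n).1 hn
    exact Finset.le_sup (f := fun p : FreeQuot (Abelianization Γ) × FreeQuot (Abelianization Γ) =>
      ((inducedClass ψ p.1).toAdd - (inducedClass ψ p.2).toAdd).natAbs)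
      (Finset.mk_mem_product hg hg')

theorem exists_phiTwist_eq (y : MonoidAlgebra ℂ (inducedClass ψ).ker) (n : ℤ) :
    ∃ b, phiTwist s s' σ ψ τ hτ b = C (algebraMap _ (CoeffField ψ) y) * T n := by
  induction y using MonoidAlgebra.induction_linear with
  | zero => exact ⟨0, by simp⟩
  | add y z hy hz =>
    obtain ⟨a, ha⟩ := hy
    obtain ⟨b, hb⟩ := hz
    exact ⟨a + b, by rw [map_add, ha, hb, map_add, map_add, add_mul]⟩
  | single v c =>
    obtain ⟨h1, h2⟩ := (kerPart_eq_iff ψ τ ((inducedClass_mk ψ τ).trans hτ) _ v n).2 rfl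
    refine ⟨MonoidAlgebra.single (v * (τ : FreeQuot (Abelianization Γ)) ^ n)
      (c * (splittingCharacter s s' σ (v * (τ : FreeQuot (Abelianization Γ)) ^ n) : ℂ)⁻¹), ?_⟩
    rw [phiTwist_single, h1, h2, mul_assoc, inv_mul_cancel₀ (Units.ne_zero _), mul_one]

/-- This is what makes `Λ` a localization of `ℂ[G]`: the coefficients lie in `K`, and their
denominators in `ℂ[U]` can be cleared. -/
theorem exists_mul_phiTwist_eq (f : LaurentPolynomial (CoeffField ψ)) :
    ∃ b m, IsUnit (phiTwist s s' σ ψ τ hτ m) ∧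
      f * phiTwist s s' σ ψ τ hτ m = phiTwist s s' σ ψ τ hτ b := by
  induction f using LaurentPolynomial.induction_on' with
  | add f g hf hg =>
    obtain ⟨b, m, hm, h⟩ := hf
    obtain ⟨b', m', hm', h'⟩ := hg
    refine ⟨b * m' + b' * m, m * m', by rw [map_mul]; exact hm.mul hm', ?_⟩
    rw [map_mul, map_add, map_mul, map_mul, ← h, ← h']
    ring
  | C_mul_T n a =>
    obtain ⟨⟨r, q⟩, hq⟩ := IsLocalization.surj
      (nonZeroDivisors (MonoidAlgebra ℂ (inducedClass ψ).ker)) a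
    obtain ⟨m, hm⟩ := exists_phiTwist_eq s s' σ ψ τ hτ q 0
    obtain ⟨b, hb⟩ := exists_phiTwist_eq s s' σ ψ τ hτ r n
    refine ⟨b, m, ?_, ?_⟩
    · rw [hm, T_zero, mul_one]
      exact (IsLocalization.map_units (CoeffField ψ) q).map C
    · rw [hm, hb, ← hq, map_mul, T_zero, mul_one]
      ring

end Embedding
end

/-! ### Cyclicity of the image of `φ` -/

noncomputable section

section Cyclic

open LaurentPolynomial Module

variable {Γ : Type u} [Group Γ] (s' : TorsionSplitting (Abelianization Γ))
  (σ : CommGroup.torsion (Abelianization Γ) →* ℂˣ) (ψ : Γ →* Multiplicative ℤ)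
  (τ : Abelianization Γ) (hτ : Abelianization.lift ψ τ = Multiplicative.ofAdd 1)

theorem phi_of (γ : Γ) :
    phi s' σ ψ τ hτ (MonoidAlgebra.of ℤ _ γ) = phiHom s' σ ψ τ hτ (Abelianization.of γ) := by
  rw [MonoidAlgebra.of_apply, phi, MonoidAlgebra.liftNCRingHom_single, map_one, one_mul]
  rfl

/-- The values are nonzero monomials, so the exponent of `t`, the element of `U` and the scalar can
be compared separately. -/
theorem phiHom_eq_iff (h h' : Abelianization Γ) :
    phiHom s' σ ψ τ hτ h = phiHom s' σ ψ τ hτ h' ↔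
      (h : FreeQuot (Abelianization Γ)) = h' ∧
        σ (s'.torsionPart h) = σ (s'.torsionPart h') := by
  have hinj := IsFractionRing.injective (MonoidAlgebra ℂ (inducedClass ψ).ker) (CoeffField ψ)
  rw [phiHom_apply s' σ ψ τ hτ rfl, phiHom_apply s' σ ψ τ hτ rfl]
  constructor
  · intro e
    rw [← single_eq_C_mul_T, ← single_eq_C_mul_T] at e
    have e' := congrArg AddMonoidAlgebra.coeff e
    rw [AddMonoidAlgebra.coeff_single, AddMonoidAlgebra.coeff_single,
      Finsupp.single_eq_single_iff] at e'
    have hne : ∀ (w : (inducedClass ψ).ker) (c : ℂˣ),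
        algebraMap _ (CoeffField ψ) (MonoidAlgebra.single w (c : ℂ)) ≠ 0 := fun w c h0 => by
      rw [map_eq_zero_iff _ hinj, MonoidAlgebra.single_eq_zero] at h0
      exact c.ne_zero h0
    obtain ⟨h1, h2⟩ := e'.resolve_right fun h0 => hne _ _ h0.1
    have h3 := congrArg MonoidAlgebra.coeff (hinj h2)
    rw [MonoidAlgebra.coeff_single, MonoidAlgebra.coeff_single,
      Finsupp.single_eq_single_iff] at h3
    obtain ⟨h4, h5⟩ := h3.resolve_right fun h0 => (Units.ne_zero _) h0.1
    refine ⟨?_, Units.ext h5⟩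
    rw [(kerPart_eq_iff ψ τ ((inducedClass_mk ψ τ).trans hτ) h _ _).1 ⟨h1, h4⟩]
    exact ((kerPart_eq_iff ψ τ ((inducedClass_mk ψ τ).trans hτ) h' _ _).1 ⟨rfl, rfl⟩).symm
  · rintro ⟨h1, h2⟩
    rw [h1, h2]

/-- The first Betti number is one if and only if the kernel of `ψ` on `H₁` is torsion. -/
theorem finrank_eq_one_iff_ker_le_torsion [Group.FG (Abelianization Γ)]
    (hτ : Abelianization.lift ψ τ = Multiplicative.ofAdd 1) :
    finrank ℤ (Additive (Abelianization Γ)) = 1 ↔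
      ∀ h, Abelianization.lift ψ h = 1 → h ∈ CommGroup.torsion (Abelianization Γ) := by
  have : Module.Finite ℤ (Additive (Abelianization Γ)) :=
    Module.Finite.iff_addGroup_fg.2 inferInstance
  let l : Additive (Abelianization Γ) →ₗ[ℤ] ℤ :=
    (MonoidHom.toAdditiveLeft (Abelianization.lift ψ)).toIntLinearMap
  have hl : Function.Surjective l := fun n => ⟨n • Additive.ofMul τ, by
    rw [map_smul]
    change n • (Abelianization.lift ψ τ).toAdd = n
    rw [hτ, toAdd_ofAdd, smul_eq_mul, mul_one]⟩
  -- `ψ` maps onto `ℤ`, so the Betti number exceeds the rank of its kernel by one.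
  have h1 := Submodule.finrank_quotient_add_finrank (LinearMap.ker l)
  rw [(l.quotKerEquivOfSurjective hl).finrank_eq, finrank_self] at h1
  have h2 : finrank ℤ (Additive (Abelianization Γ)) = 1 ↔ finrank ℤ (LinearMap.ker l) = 0 := by
    omega
  rw [h2, finrank_eq_zero_iff]
  constructor
  · intro H h hh
    obtain ⟨a, ha, hx⟩ := H ⟨Additive.ofMul h, congrArg Multiplicative.toAdd hh⟩
    exact isOfFinOrder_iff_zpow_eq_one.2 ⟨a, ha, congrArg (Additive.toMul ∘ Subtype.val) hx⟩
  · rintro H ⟨h, hh⟩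
    obtain ⟨a, ha, hx⟩ := isOfFinOrder_iff_zpow_eq_one.1
      (H h.toMul (Multiplicative.toAdd.injective hh))
    exact ⟨a, ha, Subtype.ext hx⟩

theorem isCyclic_range_phi_iff [Group.FG (Abelianization Γ)] :
    IsCyclic ((phi s' σ ψ τ hτ).toMonoidHom.comp (MonoidAlgebra.of ℤ Γ)).toHomUnits.range ↔
      σ = 1 ∧ finrank ℤ (Additive (Abelianization Γ)) = 1 := by
  set θ := ((phi s' σ ψ τ hτ).toMonoidHom.comp (MonoidAlgebra.of ℤ Γ)).toHomUnits with hθ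
  have hval : ∀ γ, (θ γ : LaurentPolynomial (CoeffField ψ)) =
      phiHom s' σ ψ τ hτ (Abelianization.of γ) := phi_of s' σ ψ τ hτ
  have heq : ∀ γ γ', θ γ = θ γ' ↔
      phiHom s' σ ψ τ hτ (Abelianization.of γ) = phiHom s' σ ψ τ hτ (Abelianization.of γ') :=
    fun γ γ' => by rw [← hval, ← hval, Units.val_inj]
  have hcyc : IsCyclic θ.range ↔ ∃ h₀ : Abelianization Γ, ∀ h, ∃ k : ℤ,
      phiHom s' σ ψ τ hτ h = phiHom s' σ ψ τ hτ (h₀ ^ k) := by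
    constructor
    · intro hc
      obtain ⟨⟨_, γ₀, rfl⟩, hg⟩ := hc.exists_generator
      refine ⟨Abelianization.of γ₀, fun h => ?_⟩
      obtain ⟨γ, rfl⟩ := QuotientGroup.mk_surjective h
      obtain ⟨k, hk⟩ := Subgroup.mem_zpowers_iff.1 (hg ⟨θ γ, γ, rfl⟩)
      refine ⟨k, ?_⟩
      have : θ (γ₀ ^ k) = θ γ := by
        rw [map_zpow]; exact congrArg Subtype.val hk
      rw [← map_zpow]
      exact ((heq _ _).1 this).symm
    · rintro ⟨h₀, H⟩
      obtain ⟨γ₀, rfl⟩ := QuotientGroup.mk_surjective h₀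
      refine ⟨⟨⟨θ γ₀, γ₀, rfl⟩, ?_⟩⟩
      rintro ⟨_, γ, rfl⟩
      obtain ⟨k, hk⟩ := H (Abelianization.of γ)
      refine Subgroup.mem_zpowers_iff.2 ⟨k, Subtype.ext ?_⟩
      change θ γ₀ ^ k = θ γ
      rw [← map_zpow]
      refine ((heq _ _).2 ?_).symm
      rw [map_zpow]
      exact hk
  rw [hcyc, finrank_eq_one_iff_ker_le_torsion ψ τ hτ]
  constructor
  · rintro ⟨h₀, H⟩
    -- Since `φ(τ)` is a power of the generator, `ψ` does not vanish on `h₀`. An element of `ker ψ`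
    -- has the same image as some `h₀ ^ k`, which forces `k = 0`.
    have key : ∀ h, Abelianization.lift ψ h = 1 →
        phiHom s' σ ψ τ hτ h = phiHom s' σ ψ τ hτ 1 := fun h hh => by
      obtain ⟨k, hk⟩ := H h
      obtain ⟨l, hl⟩ := H τ
      have e1 := congrArg (inducedClass ψ) ((phiHom_eq_iff s' σ ψ τ hτ _ _).1 hk).1
      have e2 := congrArg (inducedClass ψ) ((phiHom_eq_iff s' σ ψ τ hτ _ _).1 hl).1
      rw [inducedClass_mk, inducedClass_mk, map_zpow, hh] at e1
      rw [inducedClass_mk, inducedClass_mk, map_zpow, hτ] at e2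
      have e1' : 0 = k * (Abelianization.lift ψ h₀).toAdd := congrArg Multiplicative.toAdd e1
      have e2' : 1 = l * (Abelianization.lift ψ h₀).toAdd := congrArg Multiplicative.toAdd e2
      rcases mul_eq_zero.1 e1'.symm with rfl | h0
      · rw [hk, zpow_zero]
      · rw [h0, mul_zero] at e2'
        exact absurd e2' one_ne_zero
    refine ⟨MonoidHom.ext fun t => ?_, fun h hh => ?_⟩
    · have ht : Abelianization.lift ψ (t : Abelianization Γ) = 1 := by
        rw [← inducedClass_mk, (QuotientGroup.eq_one_iff _).2 t.2, map_one]
      have := ((phiHom_eq_iff s' σ ψ τ hτ _ _).1 (key t ht)).2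
      rw [s'.torsionPart_coe, map_one, map_one] at this
      exact this
    · have := ((phiHom_eq_iff s' σ ψ τ hτ _ _).1 (key h hh)).1
      exact (QuotientGroup.eq_one_iff _).1 this
  · rintro ⟨rfl, H⟩
    -- The quotient of `h` by `τ^ψ(h)` lies in `ker ψ`, hence is torsion, and trivial `σ` does not
    -- see torsion.
    refine ⟨τ, fun h => ⟨(Abelianization.lift ψ h).toAdd,
      (phiHom_eq_iff s' 1 ψ τ hτ _ _).2 ⟨?_, rfl⟩⟩⟩
    refine (QuotientGroup.eq_iff_div_mem).2 (H _ ?_)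
    rw [map_div, map_zpow, hτ, ← ofAdd_zsmul, smul_eq_mul, mul_one, ofAdd_toAdd, div_self']

end Cyclic

/-! ### The rank of the kernel and the Alexander-Fox norm -/

section Rank

open LaurentPolynomial Module

variable {Γ : Type u} [Group Γ] (P : FinGenPresentation Γ)
  (s s' : TorsionSplitting (Abelianization Γ))
  (σ : CommGroup.torsion (Abelianization Γ) →* ℂˣ) (ψ : Γ →* Multiplicative ℤ)
  (τ : Abelianization Γ) (hτ : Abelianization.lift ψ τ = Multiplicative.ofAdd 1)

theorem FinGenPresentation.fg (P : FinGenPresentation Γ) : Group.FG Γ :=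
  Group.fg_of_surjective P.proj_surjective

/-- `ℂ[G]` is a noetherian factorial ring, so the default value `0` of `gcdOfSet` is never used for
lack of a gcd. -/
theorem isGcdOfSet_alexanderPolynomial :
    IsGcdOfSet (s.twist σ '' P.elementaryIdeal) (P.alexanderPolynomial s σ) := by
  have : Group.FG Γ := P.fg
  have : Group.FG (Abelianization Γ) :=
    Group.fg_of_surjective (f := Abelianization.of) QuotientGroup.mk_surjective
  have : Group.FG (FreeQuot (Abelianization Γ)) :=
    Group.fg_of_surjective (f := QuotientGroup.mk' _) QuotientGroup.mk_surjective
  have := uniqueFactorizationMonoid_monoidAlgebra (FreeQuot (Abelianization Γ))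
  have := isNoetherianRing_monoidAlgebra (FreeQuot (Abelianization Γ))
  have : UniqueProds (FreeQuot (Abelianization Γ)) := uniqueProds_of_torsionFree _
  have h := exists_isGcdOfSet (s.twist σ '' P.elementaryIdeal)
  rw [FinGenPresentation.alexanderPolynomial, gcdOfSet, dif_pos h]
  exact h.choose_spec

theorem span_phiTwist_alexanderPolynomial :
    Ideal.span {a | ∃ (r : Fin (P.n - 1) → P.rels) (c : Fin (P.n - 1) → Fin P.n),
      a = ((Matrix.of fun r : P.rels => P.foxRow (phi s' σ ψ τ hτ) r.1).submatrix r c).det} =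
    Ideal.span {phiTwist s s' σ ψ τ hτ (P.alexanderPolynomial s σ)} := by
  have : Group.FG Γ := P.fg
  have : Group.FG (Abelianization Γ) :=
    Group.fg_of_surjective (f := Abelianization.of) QuotientGroup.mk_surjective
  have : Group.FG (FreeQuot (Abelianization Γ)) :=
    Group.fg_of_surjective (f := QuotientGroup.mk' _) QuotientGroup.mk_surjective
  have := uniqueFactorizationMonoid_monoidAlgebra (FreeQuot (Abelianization Γ))
  have : UniqueProds (FreeQuot (Abelianization Γ)) := uniqueProds_of_torsionFree _
  rw [← span_image_eq_of_isGcdOfSet _ (phiTwist_injective s s' σ ψ τ hτ)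
    (exists_mul_phiTwist_eq s s' σ ψ τ hτ) (isGcdOfSet_alexanderPolynomial P s σ),
    ← Set.image_comp, ← RingHom.coe_comp, phiTwist_comp_twist]
  change _ = Ideal.map (phiAb s' σ ψ τ hτ) P.elementaryIdeal
  rw [FinGenPresentation.elementaryIdeal, Ideal.map_span]
  congr 1
  have hdet : ∀ (r : Fin (P.n - 1) → P.rels) (c : Fin (P.n - 1) → Fin P.n),
      phiAb s' σ ψ τ hτ (P.alexanderMatrix.submatrix r c).det =
      ((Matrix.of fun r : P.rels => P.foxRow (phi s' σ ψ τ hτ) r.1).submatrix r c).det := by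
    intro r c
    rw [RingHom.map_det]
    refine congrArg Matrix.det (Matrix.ext fun i k => ?_)
    change phiAb s' σ ψ τ hτ (MonoidAlgebra.mapDomainRingHom ℤ (Abelianization.of.comp P.proj)
      (foxDeriv (c k) (r i).1)) =
      phi s' σ ψ τ hτ (MonoidAlgebra.mapDomainRingHom ℤ P.proj (foxDeriv (c k) (r i).1))
    rw [← phiAb_comp_mapDomain, MonoidAlgebra.mapDomainRingHom_comp]
    rfl
  ext a
  constructor
  · rintro ⟨r, c, rfl⟩
    exact ⟨_, ⟨r, c, rfl⟩, hdet r c⟩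
  · rintro ⟨_, ⟨r, c, rfl⟩, rfl⟩
    exact ⟨r, c, hdet r c⟩

/-- A loop over `τ` has derivative sent to `φ(τ) - 1`, which is nonzero because `ψ(τ) = 1`. -/
theorem foxBoundary_phi_ne_zero : P.foxBoundary (phi s' σ ψ τ hτ) ≠ 0 := by
  intro h
  obtain ⟨γ, hγ⟩ : ∃ γ, Abelianization.of γ = τ := QuotientGroup.mk_surjective τ
  have h1 := LinearMap.congr_fun h (P.foxD _ γ)
  rw [P.foxBoundary_foxD, LinearMap.zero_apply, sub_eq_zero, phi_of, hγ,
    ← map_one (phiHom s' σ ψ τ hτ)] at h1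
  have h2 := congrArg (inducedClass ψ) ((phiHom_eq_iff s' σ ψ τ hτ _ _).1 h1).1
  rw [inducedClass_mk, QuotientGroup.mk_one, map_one] at h2
  have h3 := congrArg Multiplicative.toAdd (hτ.symm.trans h2)
  exact one_ne_zero h3

/-- The rank of the kernel of the boundary map on the Alexander module is the Alexander-Fox
norm. -/
theorem finrank_ker_foxBoundary :
    (Module.Finite (CoeffField ψ) (LinearMap.ker (P.foxBoundary (phi s' σ ψ τ hτ))) ∧
      finrank (CoeffField ψ) (LinearMap.ker (P.foxBoundary (phi s' σ ψ τ hτ))) =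
        P.alexanderFoxNorm s σ ψ) ∨
    (¬ Module.Finite (CoeffField ψ) (LinearMap.ker (P.foxBoundary (phi s' σ ψ τ hτ))) ∧
      P.alexanderFoxNorm s σ ψ = 0) := by
  obtain ⟨f, hf, hcase⟩ := exists_submaximal_minors_generator
    (fun r : P.rels => P.foxRow (phi s' σ ψ τ hτ) r.1) (P.foxSpan (phi s' σ ψ τ hτ))
    (by rw [FinGenPresentation.foxSpan, Set.image_eq_range])
    (P.foxBoundary (phi s' σ ψ τ hτ)) (foxBoundary_phi_ne_zero P s' σ ψ τ hτ)
  rw [span_phiTwist_alexanderPolynomial P s s' σ ψ τ hτ] at hf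
  rcases hcase with ⟨c, hc, hfc, ⟨E⟩⟩ | ⟨h0, x, hx⟩
  · left
    choose d hd using fun i => exists_hasSpan (hc i)
    have hprod : HasSpan f (∑ i, d i) := by rw [hfc]; exact HasSpan.prod _ hd
    have hf0 : f ≠ 0 := by rw [hfc]; exact Finset.prod_ne_zero_iff.2 fun i _ => hc i
    have hΔ0 : phiTwist s s' σ ψ τ hτ (P.alexanderPolynomial s σ) ≠ 0 := by
      intro h
      rw [h] at hf
      exact hf0 (Ideal.span_singleton_eq_bot.1 (hf.symm.trans (Ideal.span_singleton_eq_bot.2 rfl)))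
    obtain ⟨e, he⟩ := exists_hasSpan hΔ0
    -- The image of `Δ^σ` and `f` generate the same ideal, so both spans are the dimension of one
    -- quotient.
    have hnorm : P.alexanderFoxNorm s σ ψ = ∑ i, d i := by
      rw [FinGenPresentation.alexanderFoxNorm, spread_eq s s' σ ψ τ hτ,
        sup_support_eq_of_hasSpan he, ← (finite_quotient_of_hasSpan he).2, hf,
        (finite_quotient_of_hasSpan hprod).2]
    have hfin := fun i => (finite_quotient_of_hasSpan (hd i)).1
    let E' := E.restrictScalars (CoeffField ψ)
    refine ⟨Module.Finite.equiv E'.symm, ?_⟩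
    rw [E'.finrank_eq, finrank_pi_fintype, hnorm]
    exact Finset.sum_congr rfl fun i _ => (finite_quotient_of_hasSpan (hd i)).2
  · right
    constructor
    · intro hfin
      -- The element `x` with trivial annihilator embeds `Λ`, which has infinite dimension over `K`.
      refine not_finite_laurent (K := CoeffField ψ) (Module.Finite.of_injective
        ((LinearMap.toSpanSingleton _ _ x).restrictScalars (CoeffField ψ)) ?_)
      exact (injective_iff_map_eq_zero _).2 hx
    · have hΔ0 : phiTwist s s' σ ψ τ hτ (P.alexanderPolynomial s σ) = 0 := by
        rw [h0] at hf
        exact Ideal.span_singleton_eq_bot.1 (hf.trans (Ideal.span_singleton_eq_bot.2 rfl))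
      rw [FinGenPresentation.alexanderFoxNorm, spread_eq s s' σ ψ τ hτ, hΔ0]
      rfl

end Rank

/-- A `K[t^{±1}]`-linear equivalence of the twisted homology is `K`-linear. -/
def TwistedH1.coeffLinearEquiv {X : Type u} [TopologicalSpace X] {x : X} {K : Type v} [Field K]
    {φ : MonoidAlgebra ℤ (FundamentalGroup X x) →+* LaurentPolynomial K} {N : Type*}
    [AddCommGroup N] [Module (LaurentPolynomial K) N] [Module K N]
    [IsScalarTower K (LaurentPolynomial K) N]
    (e : TwistedH1 φ ≃ₗ[LaurentPolynomial K] N) : TwistedH1 φ ≃ₗ[K] N where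
  __ := e.toAddEquiv
  map_smul' a y := by
    change e (LaurentPolynomial.C a • y) = a • e y
    rw [map_smul, LaurentPolynomial.C_eq_algebraMap, algebraMap_smul]

end

/-! ### The theorem for 3-manifolds -/

theorem mainTheorem5 {M : Type u} [TopologicalSpace M] [T2Space M] [CompactSpace M]
    [ConnectedSpace M] [ChartedSpace (EuclideanHalfSpace 3) M] (x : M)
    (P : FinGenPresentation (FundamentalGroup M x))
    (σ : CommGroup.torsion (Abelianization (FundamentalGroup M x)) →* ℂˣ)
    (s : TorsionSplitting (Abelianization (FundamentalGroup M x)))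
    (ψ : FundamentalGroup M x →* Multiplicative ℤ)
    (τ : Abelianization (FundamentalGroup M x))
    (hτ : Abelianization.lift ψ τ = Multiplicative.ofAdd 1)
    (s' : TorsionSplitting (Abelianization (FundamentalGroup M x)))
    (hs' : s'.lift τ = τ) :
    -- the ring homomorphism `φ` is compatible with `ψ`
    (∀ γ : FundamentalGroup M x, ∃ a : CoeffField ψ,
      phi s' σ ψ τ hτ (MonoidAlgebra.of ℤ _ γ) =
        LaurentPolynomial.T (ψ γ).toAdd * LaurentPolynomial.C a) ∧
    -- the group `φ(π)` is cyclic exactly when `σ = 1` and `b₁(M) = 1`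
    (IsCyclic ((phi s' σ ψ τ hτ).toMonoidHom.comp
        (MonoidAlgebra.of ℤ (FundamentalGroup M x))).toHomUnits.range ↔
      σ = 1 ∧ Module.finrank ℤ (Additive (Abelianization (FundamentalGroup M x))) = 1) ∧
    (Module.Finite (CoeffField ψ) (TwistedH1 (phi s' σ ψ τ hτ)) →
      Module.finrank (CoeffField ψ) (TwistedH1 (phi s' σ ψ τ hτ)) =
        P.alexanderFoxNorm s σ ψ) ∧
    (¬ Module.Finite (CoeffField ψ) (TwistedH1 (phi s' σ ψ τ hτ)) →
      P.alexanderFoxNorm s σ ψ = 0) := by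
  -- Charts make `M` locally path connected, so connectedness supplies the paths needed to compute
  -- the homology from the group.
  have : LocallyPathConnectedSpace M :=
    ChartedSpace.locallyPathConnectedSpace (EuclideanHalfSpace 3) M
  have : PathConnectedSpace M := pathConnectedSpace_iff_connectedSpace.2 inferInstance
  have : Group.FG (FundamentalGroup M x) := P.fg
  have : Group.FG (Abelianization (FundamentalGroup M x)) :=
    Group.fg_of_surjective (f := Abelianization.of) QuotientGroup.mk_surjective
  obtain ⟨e⟩ := TwistedHomology.nonempty_equiv_ker_foxBoundary (phi s' σ ψ τ hτ) P
  let E := TwistedH1.coeffLinearEquiv e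
  have hrank := finrank_ker_foxBoundary P s s' σ ψ τ hτ
  refine ⟨fun γ => ?_, isCyclic_range_phi_iff s' σ ψ τ hτ, fun hfin => ?_, fun hfin => ?_⟩
  · rw [phi_of, phiHom_apply s' σ ψ τ hτ rfl, mul_comm]
    exact ⟨_, rfl⟩
  · rw [E.finrank_eq]
    exact (hrank.resolve_right fun h => h.1 (Module.Finite.equiv E)).2
  · exact (hrank.resolve_left fun h => hfin (have := h.1; Module.Finite.equiv E.symm)).2
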